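/- Let $\Gamma=\{\sum_{j=1}^d n_j\gamma_j : n_j\in\mathbb Z\}$ be the lattice generated by a basis $\gamma_1,\dots,\gamma_d$ of $\mathbb R^d$, let $\Gamma^*=\{k\in\mathbb R^d : k\cdot\gamma\in 2\pi\mathbb Z\ \ \forall \gamma\in\Gamma\}$ be its dual lattice, $Y^*=\{k : |k\cdot\gamma_j|\le\pi\ \ \forall j\}$ the centered fundamental domain of $\Gamma^*$, $\mathbb T^d=\mathbb R^d/\Gamma$, $\mathbb T^*_d=\mathbb R^d/\Gamma^*$ and $\mathcal H_{\rm f}=L^2(\mathbb T^d)$. For $\lambda\in\Gamma^*$ let $\tau(\lambda)$ be the unitary operator $(\tau(\lambda)f)(y)=e^{i\lambda\cdot y}f(y)$ on $\mathcal H_{\rm f}$. Put $$\mathcal H_\tau=\{\varphi\in L^2_{\rm loc}(\mathbb R^d,\mathcal H_{\rm f}) : \varphi(k-\lambda)=\tau(\lambda)\varphi(k)\ \ \forall\lambda\in\Gamma^*,\ \text{for a.e. } k\},$$ $$\widetilde{\mathcal W}=\mathcal H_\tau\cap L^2_{\rm loc}(\mathbb R^d,W^{2,2}(\mathbb T^d))\cap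 W^{1,2}_{\rm loc}(\mathbb R^d,L^2(\mathbb T^d)).$$ Let $\{P_*(k)\}_{k\in\mathbb R^d}$ be a family of orthogonal projectors on $\mathcal H_{\rm f}$ with $\dim \operatorname{Ran}P_*(k)=m<\infty$ for all $k$, such that * $(\tilde P_1)$ for some $\alpha>0$ the map $k\mapsto P_*(k)$ extends to a $\mathcal B(\mathcal H_{\rm f})$-valued analytic function on $\{\kappa\in\mathbb C^d : |\operatorname{Im}\kappa_j|<\alpha\ \ \forall j\}$; * $(P_2)$ $P_*(k+\lambda)=\tau(\lambda)^{-1}P_*(k)\tau(\lambda)$ for all $k\in\mathbb R^d$ and $\lambda\in\Gamma^*$. Let $\chi=\{\chi_1,\dots,\chi_m\}\subset\widetilde{\mathcal W}$ be a Bloch frame for this family, i.e. $\{\chi_1(k),\dots,\chi_m(k)\}$ is an orthonormal basis of $\operatorname{Ran}P_*(k)$ for a.e. $k\in Y^*$. Let $[A_j(k)]_{cb}=\langle\chi_c(k),\partial_{k_j}\chi_b(k)\rangle_{\mathcal H_{\rm f}}$ and, for $U\in W^{1,2}(\mathbb T^*_d;\mathcal U(m))$, let $$\tilde F_{MV}(U;\chi)=\sum_{j=1}^d\int_{\mathbb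 T^*_d}\Big[\operatorname{tr}\big(\partial_{k_j}U^*\,\partial_{k_j}U\big)+m\sum_{a=1}^m\|\partial_{k_j}\chi_a\|^2_{\mathcal H_{\rm f}}\Big]dk+\sum_{j=1}^d\int_{\mathbb T^*_d}\operatorname{tr}\big[(U\,\partial_{k_j}U^*-\partial_{k_j}U\,U^*)A_j\big]dk+\sum_{a=1}^m\sum_{j=1}^d\Big(\int_{\mathbb T^*_d}\big[U^*(\partial_{k_j}U+A_jU)\big]_{aa}\,dk\Big)^2,$$ a real number, where $dk$ is normalized so that $\int_{\mathbb T^*_d}dk=1$. Then there exists $U\in W^{1,2}(\mathbb T^*_d;\mathcal U(m))$ which minimizes $\tilde F_{MV}(\cdot\,;\chi)$ over $W^{1,2}(\mathbb T^*_d;\mathcal U(m))$. -/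

import Mathlib

open MeasureTheory
open scoped ContDiff Matrix InnerProductSpace

noncomputable section

namespace BlochMV

/-- Euclidean space `ℝ^d`. -/
abbrev Eu (d : ℕ) : Type := EuclideanSpace ℝ (Fin d)

/-! ### Local `L²` spaces, weak derivatives, local Sobolev spaces -/

section Sobolev

variable {d : ℕ} {F : Type*} [NormedAddCommGroup F] [NormedSpace ℝ F]

/-- `u ∈ L²_loc(ℝ^d, F)`. -/
def MemL2loc (u : Eu d → F) : Prop :=
  AEStronglyMeasurable u volume ∧
    ∀ K : Set (Eu d), IsCompact K → MemLp u 2 (volume.restrict K)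

/-- `v` is the weak (distributional) partial derivative `∂u/∂x_j` on `ℝ^d`. -/
def HasWeakPartial (j : Fin d) (u v : Eu d → F) : Prop :=
  LocallyIntegrable u volume ∧ LocallyIntegrable v volume ∧
    ∀ φ : Eu d → ℝ, ContDiff ℝ ∞ φ → HasCompactSupport φ →
      ∫ x, (fderiv ℝ φ x (EuclideanSpace.single j 1)) • u x = - ∫ x, φ x • v x

/-- `u ∈ W^{1,2}_loc(ℝ^d, F)`. -/
def MemW12loc (u : Eu d → F) : Prop :=
  MemL2loc u ∧ ∀ j : Fin d, ∃ v : Eu d → F, MemL2loc v ∧ HasWeakPartial j u v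

open Classical in
/-- The weak partial derivative `∂u/∂x_j`, unique up to equality almost everywhere whenever it
exists (and set to zero if it does not exist). -/
def weakPartial (j : Fin d) (u : Eu d → F) : Eu d → F :=
  if h : ∃ v, HasWeakPartial j u v then h.choose else 0

end Sobolev

/-! ### Lattices, tori and the fibre space -/

section Lattice

variable {d : ℕ} (b : Module.Basis (Fin d) ℝ (Eu d))

/-- The lattice `Γ` generated over `ℤ` by the basis vectors `γ_1, …, γ_d`. -/
def lattice : AddSubgroup (Eu d) := (Submodule.span ℤ (Set.range b)).toAddSubgroup

/-- The dual lattice `Γ* = {k : k · γ ∈ 2πℤ for all γ ∈ Γ}`. -/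
def dualLattice : AddSubgroup (Eu d) where
  carrier := {k | ∀ γ ∈ lattice b, ∃ n : ℤ, ⟪k, γ⟫_ℝ = 2 * Real.pi * n}
  zero_mem' := fun γ _ => ⟨0, by simp⟩
  add_mem' := by
    intro x y hx hy γ hγ
    obtain ⟨n, hn⟩ := hx γ hγ
    obtain ⟨p, hp⟩ := hy γ hγ
    exact ⟨n + p, by rw [inner_add_left, hn, hp]; push_cast; ring⟩
  neg_mem' := by
    intro x hx γ hγ
    obtain ⟨n, hn⟩ := hx γ hγ
    exact ⟨-n, by rw [inner_neg_left, hn]; push_cast; ring⟩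

/-- The centered fundamental domain `Y` of `Γ`. -/
def cell : Set (Eu d) := {x | ∀ j, b.repr x j ∈ Set.Icc (-(1 / 2) : ℝ) (1 / 2)}

/-- The centered fundamental domain `Y*` of `Γ*`: if `k = ∑ k'_j γ*_j` in the dual basis
(`γ*_j · γ_i = 2π δ_{ji}`), then `k · γ_j = 2π k'_j`, so that `k'_j ∈ [-1/2, 1/2]` means
`k · γ_j ∈ [-π, π]`. -/
def dualCell : Set (Eu d) := {k | ∀ j, ⟪k, b j⟫_ℝ ∈ Set.Icc (-Real.pi) Real.pi}

/-- The torus `𝕋^d = ℝ^d / Γ`. -/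
abbrev Torus : Type := Eu d ⧸ lattice b

/-- The dual torus `𝕋*_d = ℝ^d / Γ*`. -/
abbrev DualTorus : Type := Eu d ⧸ dualLattice b

/-- Lebesgue measure on the flat torus `𝕋^d`. -/
def torusMeasure : Measure (Torus b) :=
  (volume.restrict (cell b)).map (fun x : Eu d => (x : Torus b))

/-- The fibre Hilbert space `H_f = L²(𝕋^d)`. -/
abbrev Hf : Type := Lp ℂ 2 (torusMeasure b)

/-- For `l ∈ Γ*`, the function `y ↦ exp(i l · y)` on the torus `𝕋^d`. -/
def character (l : dualLattice b) : Torus b → ℂ :=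
  fun y => Quotient.liftOn' y
    (fun x : Eu d => Complex.exp (Complex.I * ((⟪(l : Eu d), x⟫_ℝ : ℝ) : ℂ))) (by
      intro x y hxy
      rw [QuotientAddGroup.leftRel_apply] at hxy
      obtain ⟨n, hn⟩ := l.2 _ hxy
      have h : ⟪(l : Eu d), y⟫_ℝ = ⟪(l : Eu d), x⟫_ℝ + 2 * Real.pi * n := by
        rw [← hn, ← inner_add_right]; congr 1; abel
      refine Complex.exp_eq_exp_iff_exists_int.2 ⟨-n, ?_⟩
      rw [h]; push_cast; ring)

lemma character_mk (l : dualLattice b) (x : Eu d) :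
    character b l (x : Torus b) =
      Complex.exp (Complex.I * ((⟪(l : Eu d), x⟫_ℝ : ℝ) : ℂ)) := rfl

lemma measurable_character (l : dualLattice b) : Measurable (character b l) := by
  refine measurable_from_quotient.2 ?_
  have : Continuous fun x : Eu d =>
      Complex.exp (Complex.I * ((⟪(l : Eu d), x⟫_ℝ : ℝ) : ℂ)) := by fun_prop
  exact this.measurable

lemma norm_character (l : dualLattice b) (y : Torus b) : ‖character b l y‖ = 1 := by
  induction y using QuotientAddGroup.induction_on with
  | H x => rw [character_mk, mul_comm]; exact Complex.norm_exp_ofReal_mul_I _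

lemma character_neg_mul (l : dualLattice b) (y : Torus b) :
    character b (-l) y * character b l y = 1 := by
  induction y using QuotientAddGroup.induction_on with
  | H x =>
    rw [character_mk, character_mk, ← Complex.exp_add]
    simp

lemma memLp_character_mul (l : dualLattice b) (f : Hf b) :
    MemLp (fun y => character b l y * f y) 2 (torusMeasure b) :=
  (Lp.memLp f).of_le
    ((measurable_character b l).aestronglyMeasurable.mul (Lp.memLp f).1)
    (Filter.Eventually.of_forall fun y => by simp [norm_character])

/-- Multiplication by `exp(i l · y)` on `L²(𝕋^d)`. -/
def tauFun (l : dualLattice b) (f : Hf b) : Hf b := (memLp_character_mul b l f).toLp _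

lemma coeFn_tauFun (l : dualLattice b) (f : Hf b) :
    tauFun b l f =ᵐ[torusMeasure b] fun y => character b l y * f y :=
  MemLp.coeFn_toLp _

lemma tauFun_neg (l : dualLattice b) (f : Hf b) : tauFun b (-l) (tauFun b l f) = f := by
  refine Lp.ext ?_
  filter_upwards [coeFn_tauFun b (-l) (tauFun b l f), coeFn_tauFun b l f] with y h1 h2
  rw [h1, h2, ← mul_assoc, character_neg_mul, one_mul]

/-- The unitary representation `τ` of `Γ*` on `H_f`: `(τ(l) f)(y) = exp(i l · y) f(y)`. -/
def tau (l : dualLattice b) : Hf b ≃ₗᵢ[ℂ] Hf b where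
  toFun := tauFun b l
  map_add' := by
    intro f g
    refine Lp.ext ?_
    filter_upwards [coeFn_tauFun b l (f + g), coeFn_tauFun b l f, coeFn_tauFun b l g,
      Lp.coeFn_add f g, Lp.coeFn_add (tauFun b l f) (tauFun b l g)] with y h1 h2 h3 h4 h5
    rw [h1, h5, Pi.add_apply, h2, h3, h4, Pi.add_apply, mul_add]
  map_smul' := by
    intro c f
    refine Lp.ext ?_
    filter_upwards [coeFn_tauFun b l (c • f), coeFn_tauFun b l f,
      Lp.coeFn_smul c f, Lp.coeFn_smul c (tauFun b l f)] with y h1 h2 h3 h4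
    rw [h1, RingHom.id_apply, h4, Pi.smul_apply, h2, h3, Pi.smul_apply, smul_eq_mul,
      smul_eq_mul]
    ring
  invFun := tauFun b (-l)
  left_inv := tauFun_neg b l
  right_inv := by
    intro f
    have h := tauFun_neg b (-l) f
    rwa [neg_neg] at h
  norm_map' := by
    intro f
    change ‖tauFun b l f‖ = ‖f‖
    rw [Lp.norm_def, Lp.norm_def]
    congr 1
    refine eLpNorm_congr_norm_ae ?_
    filter_upwards [coeFn_tauFun b l f] with y h
    rw [h, norm_mul, norm_character, one_mul]

/-! ### Families of projectors -/

/-- `k ↦ P(k)` is a family of orthogonal projectors on `H_f`, each with range of dimension `m`. -/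
def IsProjectorFamily (m : ℕ) (P : Eu d → (Hf b →L[ℂ] Hf b)) : Prop :=
  ∀ k, IsStarProjection (P k) ∧
    Module.rank ℂ (LinearMap.range (P k : Hf b →ₗ[ℂ] Hf b)) = (m : Cardinal)

/-- The strip `Ω_α = {κ ∈ ℂ^d : |Im κ_j| < α for all j}`. -/
def strip (d : ℕ) (α : ℝ) : Set (EuclideanSpace ℂ (Fin d)) := {κ | ∀ j, |(κ j).im| < α}

/-- Property `(P̃₁)`: the map `k ↦ P(k)` extends to a `B(H_f)`-valued analytic function on the
strip `Ω_α` for some `α > 0`. -/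
def HasAnalyticExtension (P : Eu d → (Hf b →L[ℂ] Hf b)) : Prop :=
  ∃ α : ℝ, 0 < α ∧ ∃ Q : EuclideanSpace ℂ (Fin d) → (Hf b →L[ℂ] Hf b),
    AnalyticOnNhd ℂ Q (strip d α) ∧
      ∀ k : Eu d, Q (WithLp.toLp 2 fun j => ((k j : ℝ) : ℂ)) = P k

/-- Property `(P₂)`: `P(k + l) = τ(l)⁻¹ P(k) τ(l)` for all `k ∈ ℝ^d` and `l ∈ Γ*`. -/
def IsTauCovariant (P : Eu d → (Hf b →L[ℂ] Hf b)) : Prop :=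
  ∀ (k : Eu d) (l : dualLattice b) (f : Hf b),
    P (k + l) f = (tau b l).symm (P k (tau b l f))

/-! ### The spaces `H_τ` and `W̃`, and Bloch frames -/

/-- `φ ∈ H_τ`: `φ ∈ L²_loc(ℝ^d, H_f)` and, for all `l ∈ Γ*`, `φ(k - l) = τ(l) φ(k)` for almost
every `k`. -/
def MemHtau (φ : Eu d → Hf b) : Prop :=
  MemL2loc φ ∧ ∀ l : dualLattice b, ∀ᵐ k : Eu d, φ (k - l) = tau b l (φ k)

/-- `g = ∂f/∂y_j` weakly on the torus `𝕋^d`, for `f, g ∈ L²(𝕋^d)`: the `Γ`-periodic lift of `g`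
is the weak derivative on `ℝ^d` of the `Γ`-periodic lift of `f`. -/
def HasTorusPartial (j : Fin d) (f g : Hf b) : Prop :=
  HasWeakPartial j (fun x : Eu d => f (x : Torus b)) (fun x : Eu d => g (x : Torus b))

/-- `φ ∈ L²_loc(ℝ^d, W^{2,2}(𝕋^d))`: `φ` and the fibrewise weak derivatives in `y` of orders one
and two are in `L²_loc(ℝ^d, L²(𝕋^d))`. -/
def MemL2locW22 (φ : Eu d → Hf b) : Prop :=
  MemL2loc φ ∧
    ∃ (g : Fin d → Eu d → Hf b) (h : Fin d → Fin d → Eu d → Hf b),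
      (∀ i, MemL2loc (g i)) ∧ (∀ i j, MemL2loc (h i j)) ∧
      ∀ᵐ k : Eu d, (∀ i, HasTorusPartial b i (φ k) (g i k)) ∧
        ∀ i j, HasTorusPartial b j (g i k) (h i j k)

/-- `φ ∈ W̃ = H_τ ∩ L²_loc(ℝ^d, W^{2,2}(𝕋^d)) ∩ W^{1,2}_loc(ℝ^d, L²(𝕋^d))`. -/
def MemWtilde (φ : Eu d → Hf b) : Prop :=
  MemHtau b φ ∧ MemL2locW22 b φ ∧ MemW12loc φ

/-- A Bloch frame for the family `P`: functions `χ_1, …, χ_m ∈ H_τ` with `P(k) χ_a(k) = χ_a(k)`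
and `χ_a(k) ≠ 0` such that `χ_1(k), …, χ_m(k)` is an orthonormal basis of the range of `P(k)`, for
almost every `k ∈ Y*`. -/
def IsBlochFrame {m : ℕ} (P : Eu d → (Hf b →L[ℂ] Hf b)) (χ : Fin m → Eu d → Hf b) : Prop :=
  (∀ a, MemHtau b (χ a)) ∧
    ∀ᵐ k ∂(volume.restrict (dualCell b)),
      (∀ a, P k (χ a k) = χ a k ∧ χ a k ≠ 0) ∧
      Orthonormal ℂ (fun a => χ a k) ∧
      Submodule.span ℂ (Set.range fun a => χ a k) =
        LinearMap.range (P k : Hf b →ₗ[ℂ] Hf b)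

/-! ### Gauges and the Marzari–Vanderbilt functional -/

/-- The `Γ*`-periodic lift to `ℝ^d` of a map `U : 𝕋*_d → U(m)`, as a matrix-valued map. -/
def gaugeLift {m : ℕ} (U : DualTorus b → Matrix.unitaryGroup (Fin m) ℂ) (k : Eu d) :
    Matrix (Fin m) (Fin m) ℂ := (U (k : DualTorus b)).1

/-- The set `W^{1,2}(𝕋*_d; U(m))`. -/
def gaugeSpace (m : ℕ) : Set (DualTorus b → Matrix.unitaryGroup (Fin m) ℂ) :=
  {U | ∀ p q, MemW12loc fun k => gaugeLift b U k p q}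

/-- The matrix `∂U/∂k_j`. -/
def gaugePartial {m : ℕ} (j : Fin d) (U : DualTorus b → Matrix.unitaryGroup (Fin m) ℂ)
    (k : Eu d) : Matrix (Fin m) (Fin m) ℂ :=
  Matrix.of fun p q => weakPartial j (fun k' => gaugeLift b U k' p q) k

/-- The matrix `[A_j(k)]_{cb} = ⟨χ_c(k), ∂χ_b/∂k_j(k)⟩`. -/
def berry {m : ℕ} (χ : Fin m → Eu d → Hf b) (j : Fin d) (k : Eu d) :
    Matrix (Fin m) (Fin m) ℂ :=
  Matrix.of fun p q => ⟪χ p k, weakPartial j (χ q) k⟫_ℂ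

/-- The complex number given by the formula for the localization functional in terms of the gauge
`U`. The integrals over the dual torus are taken over its fundamental domain `Y*`, with respect to
the normalized measure `dk / |Y*|`. -/
def mvFormula {m : ℕ} (χ : Fin m → Eu d → Hf b)
    (U : DualTorus b → Matrix.unitaryGroup (Fin m) ℂ) : ℂ :=
  (∑ j, ⨍ k in dualCell b,
      (((gaugePartial b j U k)ᴴ * gaugePartial b j U k).trace
        + (m : ℂ) * ∑ a, ((‖weakPartial j (χ a) k‖ ^ 2 : ℝ) : ℂ)))
  + (∑ j, ⨍ k in dualCell b,
      ((gaugeLift b U k * (gaugePartial b j U k)ᴴ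
        - gaugePartial b j U k * (gaugeLift b U k)ᴴ) * berry b χ j k).trace)
  + ∑ a, ∑ j, (⨍ k in dualCell b,
      ((gaugeLift b U k)ᴴ
        * (gaugePartial b j U k + berry b χ j k * gaugeLift b U k)) a a) ^ 2

/-- The localization functional `F̃_MV(U; χ)`. For `χ` a Bloch frame in `W̃` and
`U ∈ W^{1,2}(𝕋*_d; U(m))` the number `mvFormula b χ U` is real, because `U (∂U)ᴴ`, `A_j` and
`Uᴴ (∂U + A_j U)` are anti-Hermitian. -/
def mvFunctional {m : ℕ} (χ : Fin m → Eu d → Hf b)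
    (U : DualTorus b → Matrix.unitaryGroup (Fin m) ℂ) : ℝ :=
  (mvFormula b χ U).re

end Lattice

end BlochMV

end

noncomputable section

namespace BlochMV

open Filter Topology
open scoped FourierTransform Pointwise

/-! ### Weak convergence in L² and passage to the limit in products. -/

section L2

variable {X : Type*} [MeasurableSpace X] {μ : Measure X}

/-! The proof is the direct method; the difficulty is coercivity. With z_{a,j} the average of
[U*(∂_jU + A_jU)]_{aa}, the last term of the functional is only bounded below by -∑ (Im z_{a,j})²,
which can cancel the Dirichlet term: replacing U by U·diag(e^{ik·γ_a}) with γ_a ∈ Γ leaves the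
functional unchanged while the gradient of U may grow without bound.

The same invariance repairs this. Under this change of gauge z_{a,j} becomes z_{a,j} + i(γ_a)_j, and
the local energy changes by exactly what the squares lose (`energyDensity_gauge`,
`gaugeEnergy_gauge`). So γ_a can be chosen to bring the vector (Im z_{a,j})_j into the fundamental
parallelepiped of Γ (`exists_gauge_normalized`). For gauges normalized in this way the term linear
in ∂U is absorbed by completing a square, and the functional controls ‖∂U‖² in L²
(`exists_gauge_bounded`).

A minimizing sequence can thus be taken bounded in W^{1,2}. Along a subsequence the derivatives
converge weakly in L² and the maps converge almost everywhere (`exists_subseq_periodic`), so the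
limit is again unitary. The compactness is Rellich's theorem, proved by Fourier transform after a
cutoff (`tendsto_integral_cutoff_of_weak`): low frequencies converge to zero by weak convergence,
high frequencies are uniformly small by the derivative bound.

In the limit the Dirichlet term is weakly lower semicontinuous. All other terms are integrals of a
bounded a.e. convergent factor, a fixed L² factor and a weakly convergent factor, hence converge
(`WeaklyTendsto.integral_mul_mul`, `exists_tendsto_le_gaugeEnergy`). This includes the negative
squares, for which semicontinuity alone would not suffice. -/

lemma integral_norm_sq_eq_norm_toLp_sq {f : X → ℂ} (hf : MemLp f 2 μ) :
    ∫ x, ‖f x‖ ^ 2 ∂μ = ‖hf.toLp f‖ ^ 2 := by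
  have h := @L2.inner_def X ℂ ℂ _ _ μ _ _ (hf.toLp f) (hf.toLp f)
  rw [inner_self_eq_norm_sq_to_K] at h
  have h2 : ∫ x, ⟪hf.toLp f x, hf.toLp f x⟫_ℂ ∂μ = ∫ x, ((‖f x‖ ^ 2 : ℝ) : ℂ) ∂μ := by
    refine integral_congr_ae ?_
    filter_upwards [hf.coeFn_toLp] with x hx
    rw [hx, inner_self_eq_norm_sq_to_K]
    simp
  rw [h2, integral_complex_ofReal] at h
  exact Complex.ofReal_injective (by rw [← h]; push_cast; rfl)

/-- The Cauchy–Schwarz inequality for Bochner integrals. -/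
lemma norm_integral_mul_le {f g : X → ℂ} (hf : MemLp f 2 μ) (hg : MemLp g 2 μ) :
    ‖∫ x, f x * g x ∂μ‖ ≤ √(∫ x, ‖f x‖ ^ 2 ∂μ) * √(∫ x, ‖g x‖ ^ 2 ∂μ) := by
  refine (norm_integral_le_integral_norm _).trans ?_
  simp_rw [norm_mul]
  have h := integral_mul_norm_le_Lp_mul_Lq (μ := μ) Real.HolderConjugate.two_two
    (f := f) (g := g) (by simpa using hf) (by simpa using hg)
  simpa [Real.sqrt_eq_rpow] using h

lemma integrable_norm_sq_of_memLp {E : Type*} [NormedAddCommGroup E] {f : X → E}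
    (hf : MemLp f 2 μ) : Integrable (fun x => ‖f x‖ ^ 2) μ :=
  hf.integrable_norm_pow (by norm_num)

/-- Weak convergence in `L²(μ)`, in terms of functions. -/
def WeaklyTendsto (μ : Measure X) (v : ℕ → X → ℂ) (w : X → ℂ) : Prop :=
  ∀ g : X → ℂ, MemLp g 2 μ →
    Tendsto (fun n => ∫ x, g x * v n x ∂μ) atTop (𝓝 (∫ x, g x * w x ∂μ))

lemma WeaklyTendsto.comp {v : ℕ → X → ℂ} {w : X → ℂ} (h : WeaklyTendsto μ v w)
    {φ : ℕ → ℕ} (hφ : Tendsto φ atTop atTop) : WeaklyTendsto μ (fun n => v (φ n)) w :=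
  fun g hg => (h g hg).comp hφ

/-- Weak convergence is phrased with the bilinear pairing, while the inner product is
conjugate-linear in its first slot; the conjugate of `v` reconciles the two. -/
lemma integral_mul_eq_inner {g v : X → ℂ} (hg : MemLp g 2 μ) (hv : MemLp v 2 μ) :
    ∫ x, g x * v x ∂μ = ⟪hv.star.toLp (star v), hg.toLp g⟫_ℂ := by
  rw [L2.inner_def]
  refine integral_congr_ae ?_
  filter_upwards [hg.coeFn_toLp, hv.star.coeFn_toLp] with x h1 h2
  rw [h1, h2]
  simp [RCLike.inner_apply]

/-- Bounded sequences in `L²` have weakly convergent subsequences. -/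
lemma exists_weaklyTendsto_subseq [IsSeparable μ] (v : ℕ → X → ℂ)
    (hv : ∀ n, MemLp (v n) 2 μ) (C : ℝ) (hC : ∀ n, ∫ x, ‖v n x‖ ^ 2 ∂μ ≤ C) :
    ∃ φ : ℕ → ℕ, StrictMono φ ∧ ∃ w, MemLp w 2 μ ∧ WeaklyTendsto μ (fun n => v (φ n)) w := by
  -- A finite exponent makes `Lp` over a separable measure separable, as the sequential form of
  -- Banach–Alaoglu requires.
  have : Fact ((2 : ENNReal) ≠ ⊤) := ⟨by norm_num⟩
  let H := Lp ℂ 2 μ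
  let y : ℕ → WeakDual ℂ H := fun n =>
    StrongDual.toWeakDual (InnerProductSpace.toDual ℂ H ((hv n).star.toLp (star (v n))))
  have hy : ∀ n, y n ∈ WeakDual.toStrongDual ⁻¹' Metric.closedBall (0 : StrongDual ℂ H) (√C) := by
    intro n
    have : ‖InnerProductSpace.toDual ℂ H ((hv n).star.toLp (star (v n)))‖ ≤ √C := by
      rw [LinearIsometryEquiv.norm_map]
      apply Real.le_sqrt_of_sq_le
      rw [← integral_norm_sq_eq_norm_toLp_sq]
      simpa using hC n
    simpa [y] using this
  obtain ⟨a, -, φ, hφ, ha⟩ := WeakDual.isSeqCompact_closedBall ℂ H 0 (√C) hy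
  let w0 : H := (InnerProductSpace.toDual ℂ H).symm (WeakDual.toStrongDual a)
  refine ⟨φ, hφ, star w0, (Lp.memLp w0).star, fun g hg => ?_⟩
  have h1 := (WeakDual.eval_continuous (hg.toLp g)).continuousAt.tendsto.comp ha
  have h2 : a (hg.toLp g) = ∫ x, g x * (star w0 : X → ℂ) x ∂μ := by
    rw [integral_mul_eq_inner hg (Lp.memLp w0).star]
    have : (Lp.memLp w0).star.star.toLp (star (star (w0 : X → ℂ))) = w0 := by
      simp
    rw [this, InnerProductSpace.toDual_symm_apply]
    rfl
  rw [← h2]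
  refine h1.congr fun n => ?_
  rw [integral_mul_eq_inner hg (hv (φ n))]
  rfl

/-- Successive extraction, by induction on the index set: weak convergence already obtained survives
passage to a further subsequence. -/
lemma exists_weaklyTendsto_subseq_finite [IsSeparable μ] {ι : Type*} [Finite ι]
    (v : ι → ℕ → X → ℂ) (hv : ∀ i n, MemLp (v i n) 2 μ) (C : ℝ)
    (hC : ∀ i n, ∫ x, ‖v i n x‖ ^ 2 ∂μ ≤ C) :
    ∃ φ : ℕ → ℕ, StrictMono φ ∧ ∃ w : ι → X → ℂ, ∀ i, MemLp (w i) 2 μ ∧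
      WeaklyTendsto μ (fun n => v i (φ n)) (w i) := by
  classical
  have := Fintype.ofFinite ι
  suffices H : ∀ s : Finset ι, ∃ φ : ℕ → ℕ, StrictMono φ ∧ ∃ w : ι → X → ℂ, ∀ i ∈ s,
      MemLp (w i) 2 μ ∧ WeaklyTendsto μ (fun n => v i (φ n)) (w i) by
    simpa using H Finset.univ
  intro s
  induction s using Finset.induction_on with
  | empty => exact ⟨id, strictMono_id, fun _ => 0, by simp⟩
  | insert i s hi ih =>
    obtain ⟨φ, hφ, w, hw⟩ := ih
    obtain ⟨ψ, hψ, w', hw', hw''⟩ := exists_weaklyTendsto_subseq (fun n => v i (φ n))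
      (fun n => hv i _) C (fun n => hC i _)
    refine ⟨φ ∘ ψ, hφ.comp hψ, Function.update w i w', fun k hk => ?_⟩
    by_cases hki : k = i
    · subst hki
      simpa using ⟨hw', hw''⟩
    · have hk' : k ∈ s := by simpa [hki] using hk
      rw [Function.update_of_ne hki]
      exact ⟨(hw k hk').1, (hw k hk').2.comp hψ.tendsto_atTop⟩

/-- The product of a bounded a.e. convergent sequence, a fixed `L²` function and a weakly
convergent bounded sequence in `L²`. -/
lemma WeaklyTendsto.integral_mul_mul {v : ℕ → X → ℂ} {w : X → ℂ} (h : WeaklyTendsto μ v w)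
    (hv : ∀ n, MemLp (v n) 2 μ) {C : ℝ} (hC : ∀ n, ∫ x, ‖v n x‖ ^ 2 ∂μ ≤ C)
    {s : ℕ → X → ℂ} {t : X → ℂ} (hs : ∀ n, AEStronglyMeasurable (s n) μ)
    (hs1 : ∀ n x, ‖s n x‖ ≤ 1) (hst : ∀ᵐ x ∂μ, Tendsto (fun n => s n x) atTop (𝓝 (t x)))
    {f : X → ℂ} (hf : MemLp f 2 μ) :
    Tendsto (fun n => ∫ x, s n x * f x * v n x ∂μ) atTop (𝓝 (∫ x, t x * f x * w x ∂μ)) := by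
  have ht : AEStronglyMeasurable t μ := aestronglyMeasurable_of_tendsto_ae _ hs hst
  have ht1 : ∀ᵐ x ∂μ, ‖t x‖ ≤ 1 := by
    filter_upwards [hst] with x hx
    exact le_of_tendsto hx.norm (Eventually.of_forall fun n => hs1 n x)
  have hsf : ∀ n, MemLp (fun x => s n x * f x) 2 μ := fun n =>
    hf.of_le ((hs n).mul hf.1) (Eventually.of_forall fun x => by
      rw [norm_mul]; exact mul_le_of_le_one_left (norm_nonneg _) (hs1 n x))
  have htf : MemLp (fun x => t x * f x) 2 μ :=
    hf.of_le (ht.mul hf.1) (by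
      filter_upwards [ht1] with x hx
      rw [norm_mul]; exact mul_le_of_le_one_left (norm_nonneg _) hx)
  have hd : ∀ n, MemLp (fun x => s n x * f x - t x * f x) 2 μ := fun n => (hsf n).sub htf
  -- Dominated convergence makes s_n f → t f strongly in L². The rest is the strong-times-weak
  -- argument: ∫ (s_n f - t f) v_n → 0 by Cauchy–Schwarz and ∫ t f v_n → ∫ t f w by weak
  -- convergence.
  have h0 : Tendsto (fun n => ∫ x, ‖s n x * f x - t x * f x‖ ^ 2 ∂μ) atTop (𝓝 0) := by
    have := tendsto_integral_of_dominated_convergence (μ := μ)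
      (F := fun n x => ‖s n x * f x - t x * f x‖ ^ 2) (f := fun _ => (0 : ℝ))
      (fun x => 4 * ‖f x‖ ^ 2) (fun n => (hd n).1.norm.pow 2)
      ((integrable_norm_sq_of_memLp hf).const_mul 4)
      (fun n => by
        filter_upwards [ht1] with x hx
        have h1 : ‖s n x * f x - t x * f x‖ ≤ 2 * ‖f x‖ := by
          rw [← sub_mul, norm_mul]
          gcongr
          exact (norm_sub_le _ _).trans (by linarith [hs1 n x])
        rw [Real.norm_of_nonneg (by positivity)]
        nlinarith [norm_nonneg (s n x * f x - t x * f x), norm_nonneg (f x)])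
      (by
        filter_upwards [hst] with x hx
        have := ((hx.mul_const (f x)).sub_const (t x * f x)).norm.pow 2
        simpa using this)
    simpa using this
  have h1 := h _ htf
  have h2 : Tendsto (fun n => ∫ x, (s n x * f x - t x * f x) * v n x ∂μ) atTop (𝓝 0) := by
    refine squeeze_zero_norm (a := fun n => √(∫ x, ‖s n x * f x - t x * f x‖ ^ 2 ∂μ) * √C)
      (fun n => ?_) ?_
    · refine (norm_integral_mul_le (hd n) (hv n)).trans ?_
      gcongr
      exact hC n
    · simpa using (h0.sqrt).mul_const (√C)
  have h3 := h2.add h1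
  rw [zero_add] at h3
  refine h3.congr fun n => ?_
  have i1 : Integrable (fun x => (s n x * f x - t x * f x) * v n x) μ := (hd n).integrable_mul (hv n)
  have i2 : Integrable (fun x => t x * f x * v n x) μ := htf.integrable_mul (hv n)
  rw [← integral_add i1 i2]
  refine integral_congr_ae (Eventually.of_forall fun x => ?_)
  simp only
  ring

/-- Expansion of ‖v - w‖² ≥ 0. The minorant is affine in `v`, so it passes to weak limits and
replaces the weak lower semicontinuity of the norm. -/
lemma two_mul_re_integral_sub_le {v w : X → ℂ} (hv : MemLp v 2 μ) (hw : MemLp w 2 μ) :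
    2 * (∫ x, star (w x) * v x ∂μ).re - ∫ x, ‖w x‖ ^ 2 ∂μ ≤ ∫ x, ‖v x‖ ^ 2 ∂μ := by
  have h1 : Integrable (fun x => star (w x) * v x) μ := hw.star.integrable_mul hv
  have h2 : (∫ x, star (w x) * v x ∂μ).re = ∫ x, (star (w x) * v x).re ∂μ := by
    exact (integral_re h1).symm
  have h4 : Integrable (fun x => 2 * (star (w x) * v x).re) μ := h1.re.const_mul 2
  rw [h2, ← integral_const_mul, ← integral_sub h4 (integrable_norm_sq_of_memLp hw)]
  refine integral_mono (h4.sub (integrable_norm_sq_of_memLp hw))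
    (integrable_norm_sq_of_memLp hv) fun x => ?_
  have h3 : 0 ≤ ‖v x - w x‖ ^ 2 := by positivity
  simp only [Complex.sq_norm, Complex.normSq_apply, Complex.sub_re, Complex.sub_im] at h3 ⊢
  simp
  nlinarith

end L2

/-! ### Plancherel's theorem for functions in L¹ ∩ L². -/

section Plancherel

variable {d : ℕ}

lemma integrable_smul_fourier_comm {f : Eu d → ℂ} (hf : Integrable f) {g : Eu d → ℂ}
    (hg : Integrable g) : ∫ x, 𝓕 g x • f x = ∫ x, g x • 𝓕 f x := by
  have := VectorFourier.integral_fourierIntegral_smul_eq_flip (L := innerₗ (Eu d))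
    (e := Real.fourierChar) (μ := volume) (ν := volume) Real.continuous_fourierChar
    continuous_inner hg hf
  simpa [Real.fourier_eq, VectorFourier.fourierIntegral] using this

/-- The Fourier transform of an integrable square integrable function is a.e. equal to its
Fourier transform as an element of `L²`. -/
lemma fourier_toLp_ae_eq {f : Eu d → ℂ} (hf : Integrable f) (hf2 : MemLp f 2 volume) :
    (𝓕 (hf2.toLp f) : Lp (α := Eu d) ℂ 2 volume) =ᵐ[volume] 𝓕 f := by
  have hcont : Continuous (𝓕 f) := by
    exact VectorFourier.fourierIntegral_continuous Real.continuous_fourierChar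
      (by exact continuous_inner) hf
  refine ae_eq_of_integral_contDiff_smul_eq
    ((Lp.memLp _).locallyIntegrable (by norm_num)) hcont.locallyIntegrable ?_
  intro g g_smooth g_cpt
  -- A smooth compactly supported test function is Schwartz. The Fourier transform of the L² class
  -- is known through tempered distributions, so testing it against Schwartz functions identifies it
  -- with the Fourier integral.
  have hg₁ : HasCompactSupport (Complex.ofRealCLM ∘ g) := g_cpt.comp_left rfl
  have hg₂ : ContDiff ℝ ∞ (Complex.ofRealCLM ∘ g) := by fun_prop
  set G := hg₁.toSchwartzMap hg₂ with hG
  have hGx : ∀ x, G x = (g x : ℂ) := fun x => rfl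
  have h1 := congrArg (fun T => T G) (Lp.fourier_toTemperedDistribution_eq (hf2.toLp f))
  simp only [TemperedDistribution.fourier_apply, Lp.toTemperedDistribution_apply] at h1
  have h2 : ∫ x, (𝓕 G) x • (hf2.toLp f) x = ∫ x, 𝓕 (G : Eu d → ℂ) x • f x := by
    refine integral_congr_ae ?_
    filter_upwards [hf2.coeFn_toLp] with x hx
    rw [hx, SchwartzMap.fourier_coe]
  rw [h2, integrable_smul_fourier_comm hf G.integrable] at h1
  simpa [hGx] using h1.symm

/-- Plancherel's theorem for integrable square integrable functions. -/
lemma memLp_fourier {f : Eu d → ℂ} (hf : Integrable f) (hf2 : MemLp f 2 volume) :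
    MemLp (𝓕 f) 2 volume :=
  (memLp_congr_ae (fourier_toLp_ae_eq hf hf2)).1 (Lp.memLp _)

lemma integral_norm_fourier_sq {f : Eu d → ℂ} (hf : Integrable f) (hf2 : MemLp f 2 volume) :
    ∫ ξ, ‖𝓕 f ξ‖ ^ 2 = ∫ x, ‖f x‖ ^ 2 := by
  rw [integral_norm_sq_eq_norm_toLp_sq hf2, integral_norm_sq_eq_norm_toLp_sq (memLp_fourier hf hf2),
    ← Lp.norm_fourier_eq (hf2.toLp f)]
  congr 2
  refine Lp.ext ?_
  exact ((memLp_fourier hf hf2).coeFn_toLp).trans (fourier_toLp_ae_eq hf hf2).symm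

end Plancherel

/-! ### Stability properties of L²_loc. -/

section L2loc

variable {d : ℕ} {F : Type*} [NormedAddCommGroup F]

lemma MemL2loc.congr {u v : Eu d → F} (hu : MemL2loc u) (h : u =ᵐ[volume] v) : MemL2loc v :=
  ⟨hu.1.congr h, fun K hK => (memLp_congr_ae (ae_restrict_of_ae h)).1 (hu.2 K hK)⟩

lemma MemL2loc.locallyIntegrable {u : Eu d → F} (hu : MemL2loc u) :
    LocallyIntegrable u volume := by
  rw [locallyIntegrable_iff]
  intro K hK
  have : IsFiniteMeasure (volume.restrict K : Measure (Eu d)) := ⟨by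
    simpa using hK.measure_lt_top⟩
  exact (hu.2 K hK).integrable (by norm_num)

lemma MemL2loc.sub {u v : Eu d → F} (hu : MemL2loc u) (hv : MemL2loc v) :
    MemL2loc (fun x => u x - v x) :=
  ⟨hu.1.sub hv.1, fun K hK => (hu.2 K hK).sub (hv.2 K hK)⟩

lemma MemL2loc.add {u v : Eu d → F} (hu : MemL2loc u) (hv : MemL2loc v) :
    MemL2loc (fun x => u x + v x) :=
  ⟨hu.1.add hv.1, fun K hK => (hu.2 K hK).add (hv.2 K hK)⟩

lemma memL2loc_of_continuous {u : Eu d → F} (hu : Continuous u) : MemL2loc u := by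
  refine ⟨hu.aestronglyMeasurable, fun K hK => ?_⟩
  obtain ⟨C, hC⟩ := hK.exists_bound_of_continuousOn hu.continuousOn
  have : IsFiniteMeasure (volume.restrict K : Measure (Eu d)) := ⟨by
    simpa using hK.measure_lt_top⟩
  exact MemLp.of_bound hu.aestronglyMeasurable C
    ((ae_restrict_iff' hK.measurableSet).2 (Eventually.of_forall hC))

lemma MemL2loc.continuous_mul {g u : Eu d → ℂ} (hu : MemL2loc u) (hg : Continuous g) :
    MemL2loc (fun x => g x * u x) := by
  refine ⟨hg.aestronglyMeasurable.mul hu.1, fun K hK => ?_⟩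
  obtain ⟨C, hC⟩ := hK.exists_bound_of_continuousOn hg.continuousOn
  refine MemLp.of_le_mul (c := C) (hu.2 K hK)
    (hg.aestronglyMeasurable.mul (hu.2 K hK).1) ?_
  refine (ae_restrict_iff' hK.measurableSet).2 (Eventually.of_forall fun x hx => ?_)
  rw [norm_mul]
  gcongr
  exact hC x hx

end L2loc

/-! ### Calculus of weak partial derivatives. -/

section WeakDerivative

variable {d : ℕ} {F : Type*} [NormedAddCommGroup F] [NormedSpace ℝ F]

lemma HasWeakPartial.ae_eq [CompleteSpace F] {j : Fin d} {u v v' : Eu d → F}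
    (h : HasWeakPartial j u v) (h' : HasWeakPartial j u v') : v =ᵐ[volume] v' := by
  refine ae_eq_of_integral_contDiff_smul_eq h.2.1 h'.2.1 fun g hg hg' => ?_
  have h1 := h.2.2 g hg hg'
  have h2 := h'.2.2 g hg hg'
  rw [h1] at h2
  exact neg_injective h2

lemma HasWeakPartial.weakPartial {j : Fin d} {u v : Eu d → F}
    (h : HasWeakPartial j u v) : HasWeakPartial j u (weakPartial j u) := by
  have h' : ∃ v, HasWeakPartial j u v := ⟨v, h⟩
  unfold BlochMV.weakPartial
  rw [dif_pos h']
  exact h'.choose_spec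

lemma HasWeakPartial.weakPartial_ae_eq [CompleteSpace F] {j : Fin d} {u v : Eu d → F}
    (h : HasWeakPartial j u v) : BlochMV.weakPartial j u =ᵐ[volume] v :=
  h.weakPartial.ae_eq h

lemma MemW12loc.weakPartial [CompleteSpace F] {u : Eu d → F} (hu : MemW12loc u) (j : Fin d) :
    MemL2loc (weakPartial j u) := by
  obtain ⟨v, hv, h⟩ := hu.2 j
  exact hv.congr h.weakPartial_ae_eq.symm

lemma MemW12loc.hasWeakPartial {u : Eu d → F} (hu : MemW12loc u) (j : Fin d) :
    HasWeakPartial j u (BlochMV.weakPartial j u) := by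
  obtain ⟨v, hv, h⟩ := hu.2 j
  exact h.weakPartial

lemma hasCompactSupport_fderiv_apply {G : Type*} [NormedAddCommGroup G] [NormedSpace ℝ G]
    {φ : Eu d → G} (h : HasCompactSupport φ) (e : Eu d) :
    HasCompactSupport fun x => fderiv ℝ φ x e :=
  (h.fderiv (𝕜 := ℝ)).comp_left (g := fun L : Eu d →L[ℝ] G => L e) rfl

lemma continuous_fderiv_apply {G : Type*} [NormedAddCommGroup G] [NormedSpace ℝ G]
    {φ : Eu d → G} (h : ContDiff ℝ ∞ φ) (e : Eu d) :
    Continuous fun x => fderiv ℝ φ x e :=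
  (h.continuous_fderiv (by simp)).clm_apply continuous_const

lemma integrable_mul_of_compactSupport {φ u : Eu d → ℂ} (hφ : Continuous φ)
    (hc : HasCompactSupport φ) (hu : LocallyIntegrable u volume) :
    Integrable (fun x => φ x * u x) volume :=
  hu.integrable_smul_left_of_hasCompactSupport hφ hc

lemma HasWeakPartial.sub {j : Fin d} {u v u' v' : Eu d → F}
    (h : HasWeakPartial j u v) (h' : HasWeakPartial j u' v') :
    HasWeakPartial j (fun x => u x - u' x) (fun x => v x - v' x) := by
  refine ⟨h.1.sub h'.1, h.2.1.sub h'.2.1, fun φ hφ hc => ?_⟩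
  have c1 := continuous_fderiv_apply hφ (EuclideanSpace.single j 1)
  have c2 := hasCompactSupport_fderiv_apply hc (EuclideanSpace.single j 1)
  simp only [smul_sub]
  rw [integral_sub (h.1.integrable_smul_left_of_hasCompactSupport c1 c2)
    (h'.1.integrable_smul_left_of_hasCompactSupport c1 c2),
    integral_sub (h.2.1.integrable_smul_left_of_hasCompactSupport hφ.continuous hc)
    (h'.2.1.integrable_smul_left_of_hasCompactSupport hφ.continuous hc),
    h.2.2 φ hφ hc, h'.2.2 φ hφ hc]
  abel

/-- Translation of a weak derivative. -/
lemma HasWeakPartial.comp_add_right {j : Fin d} {u v : Eu d → F} (h : HasWeakPartial j u v)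
    (l : Eu d) : HasWeakPartial j (fun x => u (x + l)) (fun x => v (x + l)) := by
  have key : ∀ w : Eu d → F, LocallyIntegrable w volume →
      LocallyIntegrable (fun x => w (x + l)) volume := by
    intro w hw
    rw [locallyIntegrable_iff] at hw ⊢
    intro K hK
    have h1 : IsCompact ((fun x => x + l) '' K) := hK.image (by fun_prop)
    have h2 := (measurePreserving_add_right (volume : Measure (Eu d)) l).integrableOn_comp_preimage
      (measurableEmbedding_addRight l) (f := w) (s := (fun x => x + l) '' K)
    exact (h2.2 (hw _ h1)).mono_set (Set.subset_preimage_image _ _)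
  refine ⟨key u h.1, key v h.2.1, fun φ hφ hc => ?_⟩
  have h1 := h.2.2 (fun x => φ (x - l)) (by fun_prop)
    (hc.comp_homeomorph (Homeomorph.subRight l))
  have h2 : ∀ x, fderiv ℝ (fun x => φ (x - l)) x = fderiv ℝ φ (x - l) := fun x =>
    fderiv_comp_sub (f := φ) (x := x) l
  simp only [h2] at h1
  rw [← integral_add_right_eq_self _ l, ← integral_add_right_eq_self (fun x => φ (x - l) • v x) l]
    at h1
  simpa using h1

/-- Weak derivatives can be tested against complex-valued functions. -/
lemma HasWeakPartial.integral_complex {j : Fin d} {u v : Eu d → ℂ} (h : HasWeakPartial j u v)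
    {Φ : Eu d → ℂ} (hΦ : ContDiff ℝ ∞ Φ) (hc : HasCompactSupport Φ) :
    ∫ x, fderiv ℝ Φ x (EuclideanSpace.single j 1) * u x = - ∫ x, Φ x * v x := by
  set e : Eu d := EuclideanSpace.single j 1
  have hr : ContDiff ℝ ∞ (fun x => (Φ x).re) := Complex.reCLM.contDiff.comp hΦ
  have hi : ContDiff ℝ ∞ (fun x => (Φ x).im) := Complex.imCLM.contDiff.comp hΦ
  have hrc : HasCompactSupport (fun x => (Φ x).re) := hc.comp_left (g := Complex.re) rfl
  have hic : HasCompactSupport (fun x => (Φ x).im) := hc.comp_left (g := Complex.im) rfl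
  have hd : ∀ x, DifferentiableAt ℝ Φ x := fun x => hΦ.differentiable (by simp) x
  have dr : ∀ x, fderiv ℝ (fun x => (Φ x).re) x e = (fderiv ℝ Φ x e).re := fun x => by
    have := (Complex.reCLM.hasFDerivAt.comp x (hd x).hasFDerivAt).fderiv
    change fderiv ℝ (Complex.reCLM ∘ Φ) x e = _
    rw [this]; rfl
  have di : ∀ x, fderiv ℝ (fun x => (Φ x).im) x e = (fderiv ℝ Φ x e).im := fun x => by
    have := (Complex.imCLM.hasFDerivAt.comp x (hd x).hasFDerivAt).fderiv
    change fderiv ℝ (Complex.imCLM ∘ Φ) x e = _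
    rw [this]; rfl
  have h1 := h.2.2 _ hr hrc
  have h2 := h.2.2 _ hi hic
  have i1 := h.1.integrable_smul_left_of_hasCompactSupport (continuous_fderiv_apply hr e)
    (hasCompactSupport_fderiv_apply hrc e)
  have i2 := h.1.integrable_smul_left_of_hasCompactSupport (continuous_fderiv_apply hi e)
    (hasCompactSupport_fderiv_apply hic e)
  have i3 := h.2.1.integrable_smul_left_of_hasCompactSupport hr.continuous hrc
  have i4 := h.2.1.integrable_smul_left_of_hasCompactSupport hi.continuous hic
  have e1 : ∀ x, fderiv ℝ Φ x e * u x = fderiv ℝ (fun x => (Φ x).re) x e • u x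
      + Complex.I * (fderiv ℝ (fun x => (Φ x).im) x e • u x) := fun x => by
    rw [dr, di, Complex.real_smul, Complex.real_smul]
    nth_rewrite 1 [← Complex.re_add_im (fderiv ℝ Φ x e)]
    ring
  have e2 : ∀ x, Φ x * v x = (Φ x).re • v x + Complex.I * ((Φ x).im • v x) := fun x => by
    rw [Complex.real_smul, Complex.real_smul]
    nth_rewrite 1 [← Complex.re_add_im (Φ x)]
    ring
  simp only [e1, e2]
  rw [integral_add i1 (i2.const_mul _), integral_add i3 (i4.const_mul _), integral_const_mul,
    integral_const_mul, h1, h2]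
  ring

/-- The product rule for a smooth function and a weakly differentiable function. -/
lemma HasWeakPartial.smooth_mul {j : Fin d} {u v : Eu d → ℂ} (h : HasWeakPartial j u v)
    {g : Eu d → ℂ} (hg : ContDiff ℝ ∞ g) :
    HasWeakPartial j (fun x => g x * u x)
      (fun x => fderiv ℝ g x (EuclideanSpace.single j 1) * u x + g x * v x) := by
  set e : Eu d := EuclideanSpace.single j 1
  have cg := continuous_fderiv_apply hg e
  have key : ∀ {f w : Eu d → ℂ}, Continuous f → LocallyIntegrable w volume →
      LocallyIntegrable (fun x => f x * w x) volume := by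
    intro f w hf hw
    rw [locallyIntegrable_iff] at hw ⊢
    exact fun K hK => (hw K hK).continuousOn_mul hf.continuousOn hK
  refine ⟨key hg.continuous h.1, (key cg h.1).add (key hg.continuous h.2.1), fun φ hφ hc => ?_⟩
  have hφ' : ContDiff ℝ ∞ (fun x => (φ x : ℂ)) := Complex.ofRealCLM.contDiff.comp hφ
  have hc' : HasCompactSupport (fun x => (φ x : ℂ)) :=
    hc.comp_left (g := fun t : ℝ => (t : ℂ)) rfl
  have h1 : ∫ x, fderiv ℝ (fun x => (φ x : ℂ) * g x) x e * u x
      = - ∫ x, (φ x : ℂ) * g x * v x := h.integral_complex (hφ'.mul hg) hc'.mul_right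
  have dφ : ∀ x, fderiv ℝ (fun x => (φ x : ℂ)) x e = ((fderiv ℝ φ x e : ℝ) : ℂ) := fun x => by
    have := (Complex.ofRealCLM.hasFDerivAt.comp x
      (hφ.differentiable (by simp) x).hasFDerivAt).fderiv
    change fderiv ℝ (Complex.ofRealCLM ∘ φ) x e = _
    rw [this]; rfl
  have dm : ∀ x, fderiv ℝ (fun x => (φ x : ℂ) * g x) x e * u x
      = fderiv ℝ φ x e • (g x * u x) + φ x • (fderiv ℝ g x e * u x) := fun x => by
    have := ((hφ'.differentiable (by simp) x).hasFDerivAt.mul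
      (hg.differentiable (by simp) x).hasFDerivAt).fderiv
    change fderiv ℝ ((fun x => (φ x : ℂ)) * g) x e * u x = _
    rw [this]
    simp only [add_apply, smul_apply, smul_eq_mul,
      Complex.real_smul, dφ]
    ring
  have i1 := (key hg.continuous h.1).integrable_smul_left_of_hasCompactSupport
    (continuous_fderiv_apply hφ e) (hasCompactSupport_fderiv_apply hc e)
  have i2 := (key cg h.1).integrable_smul_left_of_hasCompactSupport hφ.continuous hc
  have i3 := (key hg.continuous h.2.1).integrable_smul_left_of_hasCompactSupport hφ.continuous hc
  have e3 : ∀ x, (φ x : ℂ) * g x * v x = φ x • (g x * v x) := fun x => by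
    rw [Complex.real_smul]; ring
  simp only [dm, e3] at h1
  rw [integral_add i1 i2] at h1
  simp only [smul_add]
  rw [integral_add i2 i3]
  linear_combination h1

end WeakDerivative

/-! ### Local Rellich–Kondrashov theorem by Fourier transform. -/

section Rellich

variable {d : ℕ}

/-- The L² bound feeds Plancherel, and the L¹ bound gives a uniform bound on the Fourier transform.
The latter follows from ‖ψ‖‖f‖ ≤ M² + ‖f‖² on `K`. -/
lemma cutoff_bounds {ψ f : Eu d → ℂ} {K : Set (Eu d)} (hK : IsCompact K) (hψ : Continuous ψ)
    (hψK : ∀ x ∉ K, ψ x = 0) {M : ℝ} (hM : ∀ x, ‖ψ x‖ ≤ M) (hf : MemL2loc f) :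
    MemLp (fun x => ψ x * f x) 2 volume ∧ Integrable (fun x => ψ x * f x) volume ∧
      ∫ x, ‖ψ x * f x‖ ^ 2 ≤ M ^ 2 * ∫ x in K, ‖f x‖ ^ 2 ∧
      ∫ x, ‖ψ x * f x‖ ≤ M ^ 2 * volume.real K + ∫ x in K, ‖f x‖ ^ 2 := by
  have hfin : IsFiniteMeasure (volume.restrict K : Measure (Eu d)) := ⟨by
    simpa using hK.measure_lt_top⟩
  have h0 : ∀ x ∉ K, ψ x * f x = 0 := fun x hx => by simp [hψK x hx]
  have hi : (fun x => ψ x * f x) = K.indicator (fun x => ψ x * f x) :=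
    (Set.indicator_eq_self.2 fun x hx => by_contra fun h => hx (h0 x h)).symm
  have hL := (hf.continuous_mul hψ).2 K hK
  have i1 := integrable_norm_sq_of_memLp (hf.2 K hK)
  refine ⟨?_, ?_, ?_, ?_⟩
  · rw [hi, memLp_indicator_iff_restrict hK.measurableSet]
    exact hL
  · rw [hi, integrable_indicator_iff hK.measurableSet]
    exact hL.integrable (by norm_num)
  · rw [← setIntegral_eq_integral_of_forall_compl_eq_zero (s := K)
      (fun x hx => by simp [h0 x hx]), ← integral_const_mul]
    refine integral_mono (integrable_norm_sq_of_memLp hL) (i1.const_mul _) fun x => ?_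
    simp only [norm_mul, mul_pow]
    gcongr
    exact hM x
  · rw [← setIntegral_eq_integral_of_forall_compl_eq_zero (s := K)
      (fun x hx => by simp [h0 x hx])]
    have h1 : M ^ 2 * volume.real K = ∫ x in K, M ^ 2 := by simp [mul_comm]
    rw [h1, ← integral_add (integrable_const _) i1]
    refine integral_mono (hL.integrable (by norm_num)).norm ((integrable_const _).add i1) fun x => ?_
    simp only [norm_mul]
    nlinarith [hM x, norm_nonneg (f x), norm_nonneg (ψ x), sq_nonneg (M - ‖f x‖)]

lemma fourier_eq_integral_exp_mul (f : Eu d → ℂ) (ξ : Eu d) :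
    𝓕 f ξ = ∫ x, Complex.exp ((-(2 * Real.pi * ⟪x, ξ⟫_ℝ) : ℝ) * Complex.I) * f x := by
  rw [Real.fourier_eq]
  congr 1
  ext x
  rw [Circle.smul_def, Real.fourierChar_apply, smul_eq_mul]
  congr 3
  push_cast
  ring

lemma contDiff_exp_inner (ξ : Eu d) :
    ContDiff ℝ ∞ fun x : Eu d => Complex.exp ((⟪x, ξ⟫_ℝ : ℝ) * Complex.I) := by
  have : ContDiff ℝ ∞ fun x : Eu d => ((⟪x, ξ⟫_ℝ : ℝ) : ℂ) :=
    Complex.ofRealCLM.contDiff.comp (contDiff_id.inner ℝ contDiff_const)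
  exact (this.mul contDiff_const).cexp

lemma fderiv_exp_inner (ξ x : Eu d) (j : Fin d) :
    fderiv ℝ (fun x : Eu d => Complex.exp ((⟪x, ξ⟫_ℝ : ℝ) * Complex.I)) x
      (EuclideanSpace.single j 1)
      = ((ξ j : ℝ) : ℂ) * Complex.I * Complex.exp ((⟪x, ξ⟫_ℝ : ℝ) * Complex.I) := by
  have h1 : HasFDerivAt (fun x : Eu d => ⟪x, ξ⟫_ℝ) (innerSL ℝ ξ) x := by
    have := (innerSL ℝ ξ).hasFDerivAt (x := x)
    refine this.congr_of_eventuallyEq (Eventually.of_forall fun y => ?_)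
    simp [real_inner_comm]
  have h2 := ((Complex.ofRealCLM.hasFDerivAt.comp x h1).mul_const Complex.I).cexp
  have h3 := h2.fderiv
  change fderiv ℝ (fun x : Eu d => Complex.exp (((Complex.ofRealCLM ∘ fun x => ⟪x, ξ⟫_ℝ) x)
    * Complex.I)) x _ = _
  rw [h3]
  simp [EuclideanSpace.inner_single_right]
  ring

/-- Fourier transform of a localized weak derivative. -/
lemma HasWeakPartial.fourier_cutoff {j : Fin d} {u v η : Eu d → ℂ} (h : HasWeakPartial j u v)
    (hη : ContDiff ℝ ∞ η) (hc : HasCompactSupport η) (ξ : Eu d) :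
    ((2 * Real.pi * ξ j : ℝ) : ℂ) * Complex.I * 𝓕 (fun x => η x * u x) ξ
      = 𝓕 (fun x => η x * v x) ξ
        + 𝓕 (fun x => fderiv ℝ η x (EuclideanSpace.single j 1) * u x) ξ := by
  set ζ : Eu d := (-(2 * Real.pi)) • ξ with hζ
  set E : Eu d → ℂ := fun x => Complex.exp ((⟪x, ζ⟫_ℝ : ℝ) * Complex.I) with hE
  have hF : ∀ f : Eu d → ℂ, 𝓕 f ξ = ∫ x, E x * f x := fun f => by
    rw [fourier_eq_integral_exp_mul]
    simp [hE, hζ, inner_smul_right]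
  have hEs : ContDiff ℝ ∞ E := contDiff_exp_inner ζ
  -- The plane wave of frequency ξ times the cutoff is an admissible test function. The derivative
  -- falling on the wave gives the factor 2πiξ_j, and the one falling on η gives the commutator
  -- term.
  have key := h.integral_complex (hEs.mul hη) hc.mul_left
  set e : Eu d := EuclideanSpace.single j 1 with he
  have dm : ∀ x, fderiv ℝ (fun x => E x * η x) x e * u x
      = ((ζ j : ℝ) : ℂ) * Complex.I * (E x * (η x * u x)) + E x * (fderiv ℝ η x e * u x) :=
    fun x => by
    have h1 := ((hEs.differentiable (by simp) x).hasFDerivAt.mul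
      (hη.differentiable (by simp) x).hasFDerivAt).fderiv
    change fderiv ℝ (E * η) x e * u x = _
    rw [h1]
    simp only [add_apply, smul_apply, smul_eq_mul]
    rw [hE, he, fderiv_exp_inner ζ x j]
    ring
  have i1 : Integrable (fun x => E x * (η x * u x)) := by
    simpa [mul_assoc] using integrable_mul_of_compactSupport (hEs.continuous.mul hη.continuous)
      hc.mul_left h.1
  have i2 : Integrable (fun x => E x * (fderiv ℝ η x e * u x)) := by
    simpa [mul_assoc] using integrable_mul_of_compactSupport
      (hEs.continuous.mul (continuous_fderiv_apply hη e))
      (hasCompactSupport_fderiv_apply hc e).mul_left h.1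
  change ∫ x, fderiv ℝ (fun x => E x * η x) x e * u x = -∫ x, E x * η x * v x at key
  simp only [dm, mul_assoc (E _)] at key
  rw [integral_add (i1.const_mul _) i2, integral_const_mul] at key
  rw [hF, hF, hF]
  have hz : ((ζ j : ℝ) : ℂ) = -((2 * Real.pi * ξ j : ℝ) : ℂ) := by simp [hζ]
  rw [hz] at key
  linear_combination -key

/-- A local version of the Rellich–Kondrashov theorem. -/
theorem tendsto_integral_cutoff_of_weak {η : Eu d → ℂ} (hη : ContDiff ℝ ∞ η)
    (hc : HasCompactSupport η) (w : ℕ → Eu d → ℂ) (v : Fin d → ℕ → Eu d → ℂ)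
    (hw : ∀ n, MemL2loc (w n)) (hv : ∀ j n, MemL2loc (v j n))
    (hwv : ∀ j n, HasWeakPartial j (w n) (v j n)) (C : ℝ)
    (hCw : ∀ n, ∫ x in tsupport η, ‖w n x‖ ^ 2 ≤ C)
    (hCv : ∀ j n, ∫ x in tsupport η, ‖v j n x‖ ^ 2 ≤ C)
    (hweak : ∀ φ : Eu d → ℂ, Continuous φ → HasCompactSupport φ →
      Tendsto (fun n => ∫ x, φ x * w n x) atTop (𝓝 0)) :
    Tendsto (fun n => ∫ x, ‖η x * w n x‖ ^ 2) atTop (𝓝 0) := by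
  set K := tsupport η with hKdef
  have hK : IsCompact K := hc
  let dη : Fin d → Eu d → ℂ := fun j x => fderiv ℝ η x (EuclideanSpace.single j 1)
  have hdη : ∀ j, Continuous (dη j) := fun j => continuous_fderiv_apply hη _
  have hη0 : ∀ x ∉ K, η x = 0 := fun x hx => image_eq_zero_of_notMem_tsupport hx
  have hdη0 : ∀ j, ∀ x ∉ K, dη j x = 0 := fun j x hx => by
    have : fderiv ℝ η x = 0 := by
      by_contra h
      exact hx (support_fderiv_subset ℝ h)
    simp [dη, this]
  obtain ⟨M, hM, hM'⟩ : ∃ M : ℝ, (∀ x, ‖η x‖ ≤ M) ∧ ∀ j x, ‖dη j x‖ ≤ M := by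
    obtain ⟨M0, h0⟩ := hc.exists_bound_of_continuous hη.continuous
    choose M1 h1 using fun j => (hasCompactSupport_fderiv_apply hc
      (EuclideanSpace.single j 1)).exists_bound_of_continuous (hdη j)
    refine ⟨|M0| + ∑ j, |M1 j|, fun x => ?_, fun j x => ?_⟩
    · exact (h0 x).trans ((le_abs_self _).trans (le_add_of_nonneg_right
        (Finset.sum_nonneg fun _ _ => abs_nonneg _)))
    · exact (h1 j x).trans ((le_abs_self _).trans ((Finset.single_le_sum
        (f := fun j => |M1 j|) (fun _ _ => abs_nonneg _) (Finset.mem_univ j)).trans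
        (le_add_of_nonneg_left (abs_nonneg _))))
  have b1 := fun n => cutoff_bounds hK hη.continuous hη0 hM (hw n)
  have b2 := fun j n => cutoff_bounds hK hη.continuous hη0 hM (hv j n)
  have b3 := fun j n => cutoff_bounds hK (hdη j) (hdη0 j) (hM' j) (hw n)
  let f : ℕ → Eu d → ℂ := fun n x => η x * w n x
  -- `G n` dominates ‖ξ‖²‖𝓕(η w_n)‖², and its integral is bounded uniformly in `n` by Plancherel.
  let G : ℕ → Eu d → ℝ := fun n ξ => ∑ j, (‖𝓕 (fun x => η x * v j n x) ξ‖ ^ 2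
    + ‖𝓕 (fun x => dη j x * w n x) ξ‖ ^ 2)
  have iv : ∀ j n, Integrable (fun ξ => ‖𝓕 (fun x => η x * v j n x) ξ‖ ^ 2) := fun j n =>
    integrable_norm_sq_of_memLp (memLp_fourier (b2 j n).2.1 (b2 j n).1)
  have iw : ∀ j n, Integrable (fun ξ => ‖𝓕 (fun x => dη j x * w n x) ξ‖ ^ 2) := fun j n =>
    integrable_norm_sq_of_memLp (memLp_fourier (b3 j n).2.1 (b3 j n).1)
  have iG : ∀ n, Integrable (G n) := fun n =>
    integrable_finsetSum _ fun j _ => (iv j n).add (iw j n)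
  set D : ℝ := ∑ _j : Fin d, (M ^ 2 * C + M ^ 2 * C) with hD
  have hGD : ∀ n, ∫ ξ, G n ξ ≤ D := fun n => by
    have h1 : ∫ ξ, G n ξ = ∑ j, ∫ ξ, (‖𝓕 (fun x => η x * v j n x) ξ‖ ^ 2
        + ‖𝓕 (fun x => dη j x * w n x) ξ‖ ^ 2) :=
      integral_finsetSum _ fun j _ => (iv j n).add (iw j n)
    rw [h1]
    refine Finset.sum_le_sum fun j _ => ?_
    rw [integral_add (iv j n) (iw j n), integral_norm_fourier_sq (b2 j n).2.1 (b2 j n).1,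
      integral_norm_fourier_sq (b3 j n).2.1 (b3 j n).1]
    refine add_le_add ((b2 j n).2.2.1.trans ?_) ((b3 j n).2.2.1.trans ?_)
    · gcongr; exact hCv j n
    · gcongr; exact hCw n
  have hG0 : ∀ n ξ, 0 ≤ G n ξ := fun n ξ => by positivity
  have hfG : ∀ n ξ, ‖ξ‖ ^ 2 * ‖𝓕 (f n) ξ‖ ^ 2 ≤ G n ξ := fun n ξ => by
    rw [EuclideanSpace.norm_sq_eq, Finset.sum_mul]
    refine Finset.sum_le_sum fun j _ => ?_
    have h1 := congrArg norm ((hwv j n).fourier_cutoff hη hc ξ)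
    rw [norm_mul, norm_mul, Complex.norm_I, Complex.norm_real, mul_one, norm_mul] at h1
    have h2 := norm_add_le (𝓕 (fun x => η x * v j n x) ξ) (𝓕 (fun x => dη j x * w n x) ξ)
    -- Only 2 ≤ 2π is needed: (a + b)² ≤ 2(a² + b²) is already covered by the resulting factor 4.
    have hpi : (2 : ℝ) ≤ ‖2 * Real.pi‖ := by
      rw [Real.norm_of_nonneg (by positivity)]
      nlinarith [Real.pi_gt_three]
    have h3 : 2 * (‖ξ j‖ * ‖𝓕 (f n) ξ‖) ≤ ‖𝓕 (fun x => η x * v j n x) ξ‖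
        + ‖𝓕 (fun x => dη j x * w n x) ξ‖ := by
      refine le_trans ?_ h2
      refine le_trans ?_ h1.le
      rw [mul_assoc]
      gcongr
    have h4 : 0 ≤ ‖ξ j‖ * ‖𝓕 (f n) ξ‖ := by positivity
    rw [← mul_pow]
    nlinarith [sq_nonneg (‖𝓕 (fun x => η x * v j n x) ξ‖ - ‖𝓕 (fun x => dη j x * w n x) ξ‖)]
  have ifn : ∀ n, Integrable (fun ξ => ‖𝓕 (f n) ξ‖ ^ 2) := fun n =>
    integrable_norm_sq_of_memLp (memLp_fourier (b1 n).2.1 (b1 n).1)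
  -- Each Fourier coefficient is an integral of w_n against a fixed continuous compactly supported
  -- function, so weak convergence to zero gives pointwise convergence.
  have hpt : ∀ ξ, Tendsto (fun n => 𝓕 (f n) ξ) atTop (𝓝 0) := fun ξ => by
    have hE := (contDiff_exp_inner ((-(2 * Real.pi)) • ξ)).continuous
    have := hweak (fun x => Complex.exp ((⟪x, (-(2 * Real.pi)) • ξ⟫_ℝ : ℝ) * Complex.I) * η x)
      (hE.mul hη.continuous) hc.mul_left
    refine this.congr fun n => ?_
    rw [fourier_eq_integral_exp_mul]
    simp [f, inner_smul_right, mul_assoc]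
  have hbd : ∀ n ξ, ‖𝓕 (f n) ξ‖ ≤ M ^ 2 * volume.real K + C := fun n ξ => by
    rw [fourier_eq_integral_exp_mul]
    refine (norm_integral_le_integral_norm _).trans ?_
    simp only [norm_mul, Complex.norm_exp_ofReal_mul_I, one_mul, f]
    have := (b1 n).2.2.2
    simp only [norm_mul] at this
    exact this.trans (by gcongr; exact hCw n)
  have hball : ∀ R : ℝ, Tendsto (fun n => ∫ ξ in Metric.closedBall (0 : Eu d) R, ‖𝓕 (f n) ξ‖ ^ 2)
      atTop (𝓝 0) := fun R => by
    have hfin : IsFiniteMeasure (volume.restrict (Metric.closedBall (0 : Eu d) R)) := ⟨by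
      simpa using (isCompact_closedBall (0 : Eu d) R).measure_lt_top⟩
    have := tendsto_integral_of_dominated_convergence
      (μ := volume.restrict (Metric.closedBall (0 : Eu d) R))
      (F := fun n ξ => ‖𝓕 (f n) ξ‖ ^ 2) (f := fun _ => (0 : ℝ))
      (fun _ => (M ^ 2 * volume.real K + C) ^ 2) (fun n => (ifn n).1.restrict)
      (integrable_const _)
      (fun n => Eventually.of_forall fun ξ => by
        rw [Real.norm_of_nonneg (by positivity)]
        gcongr
        exact hbd n ξ)
      (Eventually.of_forall fun ξ => by simpa using (hpt ξ).norm.pow 2)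
    simpa using this
  -- Outside the ball of radius R the weight ‖ξ‖² exceeds R², so the tail is at most D / R²
  -- uniformly in `n`.
  have hsplit : ∀ R : ℝ, 0 < R → ∀ n, ∫ ξ, ‖𝓕 (f n) ξ‖ ^ 2
      ≤ (∫ ξ in Metric.closedBall (0 : Eu d) R, ‖𝓕 (f n) ξ‖ ^ 2) + D / R ^ 2 := by
    intro R hR n
    have hm : MeasurableSet (Metric.closedBall (0 : Eu d) R) := measurableSet_closedBall
    rw [← integral_add_compl hm (ifn n)]
    gcongr
    calc ∫ ξ in (Metric.closedBall (0 : Eu d) R)ᶜ, ‖𝓕 (f n) ξ‖ ^ 2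
        ≤ ∫ ξ in (Metric.closedBall (0 : Eu d) R)ᶜ, G n ξ / R ^ 2 := by
          refine setIntegral_mono_on (ifn n).integrableOn ((iG n).div_const _).integrableOn
            hm.compl fun ξ hξ => ?_
          have hξ' : R < ‖ξ‖ := by simpa using hξ
          rw [le_div_iff₀ (by positivity)]
          refine le_trans ?_ (hfG n ξ)
          rw [mul_comm]
          gcongr
      _ ≤ ∫ ξ, G n ξ / R ^ 2 := setIntegral_le_integral ((iG n).div_const _)
          (Eventually.of_forall fun ξ => div_nonneg (hG0 n ξ) (by positivity))
      _ ≤ D / R ^ 2 := by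
          rw [integral_div]
          gcongr
          exact hGD n
  have hfin : Tendsto (fun n => ∫ ξ, ‖𝓕 (f n) ξ‖ ^ 2) atTop (𝓝 0) := by
    rw [Metric.tendsto_atTop]
    intro ε hε
    obtain ⟨R, hR, hRD⟩ : ∃ R : ℝ, 0 < R ∧ D / R ^ 2 < ε / 2 := by
      have h1 : Tendsto (fun R : ℝ => D / R ^ 2) atTop (𝓝 0) :=
        tendsto_const_nhds.div_atTop (tendsto_pow_atTop (by norm_num))
      obtain ⟨R, h2, h3⟩ := ((h1.eventually_lt_const (half_pos hε)).and
        (eventually_gt_atTop 0)).exists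
      exact ⟨R, h3, h2⟩
    obtain ⟨N, hN⟩ := eventually_atTop.1 ((hball R).eventually_lt_const (half_pos hε))
    refine ⟨N, fun n hn => ?_⟩
    rw [Real.dist_0_eq_abs, abs_of_nonneg (integral_nonneg fun ξ => by positivity)]
    linarith [hsplit R hR n, hN n hn]
  refine hfin.congr fun n => ?_
  exact integral_norm_fourier_sq (b1 n).2.1 (b1 n).1

end Rellich

/-! ### Dual lattice, fundamental domain and periodic functions. -/

section DualLattice

variable {d : ℕ} (b : Module.Basis (Fin d) ℝ (Eu d))

/-- The coordinates `k ↦ (k · γ_j)_j`. -/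
def innerCoords : Eu d ≃ₗ[ℝ] (Fin d → ℝ) :=
  LinearMap.linearEquivOfInjective
    (LinearMap.pi fun j => (innerSL ℝ (b j) : Eu d →L[ℝ] ℝ).toLinearMap)
    (by
      rw [← LinearMap.ker_eq_bot, LinearMap.ker_eq_bot']
      intro k hk
      have h1 : ∀ j, ⟪b j, k⟫_ℝ = 0 := fun j => congrFun hk j
      exact InnerProductSpace.ext_inner_left_basis b fun j => by rw [h1 j, inner_zero_right])
    (by simp)

lemma innerCoords_apply (k : Eu d) (j : Fin d) : innerCoords b k j = ⟪k, b j⟫_ℝ := by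
  simp [innerCoords, LinearMap.linearEquivOfInjective_apply, real_inner_comm]

lemma mem_dualLattice_iff (k : Eu d) :
    k ∈ dualLattice b ↔ ∀ j, ∃ n : ℤ, innerCoords b k j = 2 * Real.pi * n := by
  simp only [innerCoords_apply]
  refine ⟨fun h j => h _ (Submodule.subset_span ⟨j, rfl⟩), fun h γ hγ => ?_⟩
  have hγ' : γ ∈ Submodule.span ℤ (Set.range b) := hγ
  induction hγ' using Submodule.span_induction with
  | mem x hx => obtain ⟨j, rfl⟩ := hx; exact h j
  | zero => exact ⟨0, by simp⟩
  | add x y hx hy h1 h2 =>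
    obtain ⟨n, hn⟩ := h1 hx
    obtain ⟨p, hp⟩ := h2 hy
    exact ⟨n + p, by rw [inner_add_right, hn, hp]; push_cast; ring⟩
  | smul a x hx h1 =>
    obtain ⟨n, hn⟩ := h1 hx
    refine ⟨a * n, ?_⟩
    rw [← Int.cast_smul_eq_zsmul ℝ, inner_smul_right, hn]
    push_cast; ring

/-- Integer coordinates of a vector of the dual lattice. -/
def intCoords (l : dualLattice b) (j : Fin d) : ℤ := ((mem_dualLattice_iff b l).1 l.2 j).choose

lemma intCoords_spec (l : dualLattice b) (j : Fin d) :
    innerCoords b l j = 2 * Real.pi * intCoords b l j :=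
  ((mem_dualLattice_iff b l).1 l.2 j).choose_spec

lemma intCoords_injective : Function.Injective (intCoords b) := by
  intro l l' h
  refine Subtype.ext ((innerCoords b).injective (funext fun j => ?_))
  rw [intCoords_spec, intCoords_spec, h]

instance : Countable (dualLattice b) := (intCoords_injective b).countable

/-- The half-open fundamental domain of the dual lattice. -/
def halfOpenCell : Set (Eu d) := innerCoords b ⁻¹' Set.univ.pi fun _ => Set.Ico (-Real.pi) Real.pi

lemma continuous_innerCoords : Continuous (innerCoords b) :=
  LinearMap.continuous_of_finiteDimensional (innerCoords b).toLinearMap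

lemma continuous_innerCoords_symm : Continuous (innerCoords b).symm :=
  LinearMap.continuous_of_finiteDimensional (innerCoords b).symm.toLinearMap

lemma dualCell_eq :
    dualCell b = innerCoords b ⁻¹' Set.univ.pi fun _ => Set.Icc (-Real.pi) Real.pi := by
  ext k
  simp only [dualCell, Set.mem_preimage, Set.mem_univ_pi, innerCoords_apply]
  rfl

lemma measurableSet_halfOpenCell : MeasurableSet (halfOpenCell b) :=
  (continuous_innerCoords b).measurable
    (MeasurableSet.univ_pi fun _ => measurableSet_Ico)

lemma isCompact_dualCell : IsCompact (dualCell b) := by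
  rw [dualCell_eq]
  have : innerCoords b ⁻¹' (Set.univ.pi fun _ => Set.Icc (-Real.pi) Real.pi)
      = (innerCoords b).symm '' (Set.univ.pi fun _ => Set.Icc (-Real.pi) Real.pi) :=
    ((innerCoords b).symm.toEquiv.image_eq_preimage_symm _).symm
  rw [this]
  exact (isCompact_univ_pi fun _ => isCompact_Icc).image (continuous_innerCoords_symm b)

lemma halfOpenCell_subset : halfOpenCell b ⊆ dualCell b := by
  rw [dualCell_eq]
  exact Set.preimage_mono (Set.pi_mono fun _ _ => Set.Ico_subset_Icc_self)

/-- The two cells differ by a null set. This permits integrating over the closed compact cell while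
using the half-open one, whose translates tile exactly, for unfolding. -/
lemma restrict_dualCell :
    (volume.restrict (dualCell b) : Measure (Eu d)) = volume.restrict (halfOpenCell b) := by
  refine Measure.restrict_congr_set ?_
  rw [dualCell_eq]
  have h1 : Measure.QuasiMeasurePreserving (innerCoords b) (volume : Measure (Eu d)) volume :=
    ⟨(continuous_innerCoords b).measurable, by
      have : ((volume : Measure (Eu d)).map
          (innerCoords b).toContinuousLinearEquiv).IsAddHaarMeasure := inferInstance
      exact Measure.absolutelyContinuous_isAddHaarMeasure
        ((volume : Measure (Eu d)).map (innerCoords b).toContinuousLinearEquiv) volume⟩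
  have h2 := Measure.univ_pi_Ico_ae_eq_Icc (μ := fun _ : Fin d => (volume : Measure ℝ))
    (f := fun _ => -Real.pi) (g := fun _ => Real.pi)
  rw [← volume_pi] at h2
  have h3 := h1.preimage_ae_eq h2.symm
  rwa [← Set.pi_univ_Icc] at h3

/-- The vector of the dual lattice that moves a point into the half-open cell. -/
def latticePart (k : Eu d) : Eu d :=
  (innerCoords b).symm fun j =>
    2 * Real.pi * ((⌊(innerCoords b k j + Real.pi) / (2 * Real.pi)⌋ : ℤ) : ℝ)

lemma latticePart_mem (k : Eu d) : latticePart b k ∈ dualLattice b := by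
  rw [mem_dualLattice_iff]
  intro j
  exact ⟨_, by simp [latticePart]; rfl⟩

/-- The representative in the half-open cell. -/
def cellRep (k : Eu d) : Eu d := k - latticePart b k

/-- Exactly one integer translate of a real number lies in the half-open interval; existence and
uniqueness of the representative modulo Γ* both reduce to this coordinatewise. -/
lemma mem_halfOpenCell_sub_iff (x : ℝ) (n : ℤ) :
    x - 2 * Real.pi * n ∈ Set.Ico (-Real.pi) Real.pi ↔
      ⌊(x + Real.pi) / (2 * Real.pi)⌋ = n := by
  have := Real.pi_pos
  rw [Int.floor_eq_iff, le_div_iff₀ (by positivity), div_lt_iff₀ (by positivity), Set.mem_Ico]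
  constructor <;> rintro ⟨h1, h2⟩ <;> constructor <;> nlinarith

lemma cellRep_mem (k : Eu d) : cellRep b k ∈ halfOpenCell b := by
  intro j _
  simp only [cellRep, map_sub, Pi.sub_apply, latticePart, LinearEquiv.apply_symm_apply]
  rw [mem_halfOpenCell_sub_iff]

lemma sub_mem_halfOpenCell_iff (k : Eu d) (l : dualLattice b) :
    k - l ∈ halfOpenCell b ↔ (l : Eu d) = latticePart b k := by
  constructor
  · intro h
    apply (innerCoords b).injective
    ext j
    have h1 := h j (Set.mem_univ j)
    rw [map_sub, Pi.sub_apply, intCoords_spec, mem_halfOpenCell_sub_iff] at h1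
    rw [intCoords_spec, ← h1]
    simp [latticePart]
  · intro h
    rw [h]
    exact cellRep_mem b k

lemma cellRep_eq_self {k : Eu d} (hk : k ∈ halfOpenCell b) : cellRep b k = k := by
  have := (sub_mem_halfOpenCell_iff b k 0).1 (by simpa using hk)
  simp [cellRep, ← this]

lemma cellRep_add (k : Eu d) (l : dualLattice b) : cellRep b (k + l) = cellRep b k := by
  have h1 : k - (⟨latticePart b (k + l), latticePart_mem b _⟩ - l : dualLattice b)
      ∈ halfOpenCell b := by
    have := cellRep_mem b (k + l)
    rw [cellRep] at this
    convert! this using 1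
    simp only [AddSubgroup.coe_sub]
    abel
  have h2 := (sub_mem_halfOpenCell_iff b k _).1 h1
  simp only [AddSubgroup.coe_sub] at h2
  rw [cellRep, cellRep, ← h2]
  abel

lemma measurable_cellRep : Measurable (cellRep b) := by
  refine measurable_id.sub ((continuous_innerCoords_symm b).measurable.comp ?_)
  refine measurable_pi_iff.2 fun j => ?_
  have h1 : Measurable fun k => innerCoords b k j :=
    ((continuous_apply j).comp (continuous_innerCoords b)).measurable
  have h2 : Measurable fun k => ((⌊(innerCoords b k j + Real.pi) / (2 * Real.pi)⌋ : ℤ) : ℝ) :=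
    (measurable_from_top (f := fun n : ℤ => (n : ℝ))).comp
      (((h1.add_const _).div_const _).floor)
  exact h2.const_mul _

lemma isAddFundamentalDomain_halfOpenCell :
    IsAddFundamentalDomain (dualLattice b) (halfOpenCell b) (volume : Measure (Eu d)) := by
  refine IsAddFundamentalDomain.mk' (measurableSet_halfOpenCell b).nullMeasurableSet fun k => ?_
  refine ⟨-⟨latticePart b k, latticePart_mem b k⟩, ?_, fun l hl => ?_⟩
  · have := cellRep_mem b k
    rw [cellRep, sub_eq_neg_add] at this
    exact this
  · have h1 : k - (-l : dualLattice b) ∈ halfOpenCell b := by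
      have h2 : (l : Eu d) + k ∈ halfOpenCell b := hl
      convert! h2 using 1
      simp [add_comm]
    have h2 := (sub_mem_halfOpenCell_iff b k _).1 h1
    rw [eq_neg_iff_add_eq_zero, add_comm, ← eq_neg_iff_add_eq_zero]
    exact Subtype.ext h2.symm

lemma volume_dualCell_ne_zero : volume (dualCell b) ≠ 0 := by
  have h1 := (isAddFundamentalDomain_halfOpenCell b).measure_ne_zero (NeZero.ne _)
  exact fun h => h1 (measure_mono_null (halfOpenCell_subset b) h)

/-- A compact set meets finitely many translates of the cell. -/
lemma finite_translates {K : Set (Eu d)} (hK : IsCompact K) :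
    {l : dualLattice b | ∃ k ∈ halfOpenCell b, k + l ∈ K}.Finite := by
  obtain ⟨C, hC⟩ := hK.exists_bound_of_continuousOn (continuous_innerCoords b).continuousOn
  refine Set.Finite.of_finite_image (f := intCoords b) ?_ (intCoords_injective b).injOn
  -- If a coordinate has modulus at most π and its translate by 2πn has modulus at most C, then
  -- 2π|n| ≤ C + π, which puts n well within this range.
  refine (Set.Finite.pi' fun _ : Fin d => Set.finite_Icc (-(⌈C⌉ + 1)) (⌈C⌉ + 1)).subset ?_
  rintro _ ⟨l, ⟨k, hk, hkl⟩, rfl⟩ j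
  have h1 := (norm_le_pi_norm _ j).trans (hC _ hkl)
  have h2 := hk j (Set.mem_univ j)
  rw [map_add, Pi.add_apply, intCoords_spec, Real.norm_eq_abs, abs_le] at h1
  have hp := Real.pi_gt_three
  have hC' := Int.le_ceil C
  have hC0 : 0 ≤ C := (norm_nonneg _).trans (hC _ hkl)
  set n : ℤ := intCoords b l j
  have a1 : ((n : ℤ) : ℝ) ≤ ((⌈C⌉ + 1 : ℤ) : ℝ) := by
    push_cast
    by_contra! h
    nlinarith [h2.1, h2.2]
  have a2 : ((-(⌈C⌉ + 1) : ℤ) : ℝ) ≤ ((n : ℤ) : ℝ) := by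
    push_cast
    by_contra! h
    nlinarith [h2.1, h2.2]
  exact ⟨by exact_mod_cast a2, by exact_mod_cast a1⟩

/-- Periodicity almost everywhere with respect to the dual lattice. -/
def AEPeriodic {F : Type*} (v : Eu d → F) : Prop :=
  ∀ l : dualLattice b, ∀ᵐ k : Eu d, v (k + l) = v k

variable {b}

/-- The exceptional set is invariant under Γ* and null on a fundamental domain, hence null. -/
lemma ae_of_ae_dualCell {p : Eu d → Prop} (hp : ∀ k, ∀ l : dualLattice b, p (k + l) ↔ p k)
    (h : ∀ᵐ k ∂(volume.restrict (dualCell b)), p k) : ∀ᵐ k : Eu d, p k := by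
  rw [restrict_dualCell] at h
  have h0 : volume ({k | ¬ p k} ∩ halfOpenCell b) = 0 := by
    rw [ae_iff, Measure.restrict_apply₀' (measurableSet_halfOpenCell b).nullMeasurableSet] at h
    exact h
  refine (isAddFundamentalDomain_halfOpenCell b).measure_zero_of_invariant _ (fun l => ?_) h0
  ext k
  rw [Set.mem_vadd_set_iff_neg_vadd_mem]
  have : (-l +ᵥ k : Eu d) = k + (-l : dualLattice b) := by
    rw [AddSubgroup.vadd_def, vadd_eq_add, add_comm]
  rw [this]
  exact not_congr (hp k (-l))

/-- Cutting `K` along the translates of the cell leaves finitely many pieces, each contributing at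
most the integral over one period. The constant depends on `K` and the lattice alone, which keeps
bounds uniform along sequences. -/
lemma exists_lintegral_le {K : Set (Eu d)} (hK : IsCompact K) (b : Module.Basis (Fin d) ℝ (Eu d)) :
    ∃ N : ℕ, ∀ v : Eu d → ENNReal, AEPeriodic b v →
      ∫⁻ k in K, v k ≤ N * ∫⁻ k in dualCell b, v k := by
  classical
  refine ⟨(finite_translates b hK).toFinset.card, fun v hv => ?_⟩
  rw [restrict_dualCell, (isAddFundamentalDomain_halfOpenCell b).setLIntegral_eq_tsum',
    -- Reindexing by l ↦ -l turns the summation index into the translation that carries points of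
    -- the cell into `K`, as in `finite_translates`.
    ← (Equiv.neg (dualLattice b)).tsum_eq,
    tsum_eq_sum (s := (finite_translates b hK).toFinset)]
  · rw [← nsmul_eq_mul]
    refine Finset.sum_le_card_nsmul _ _ _ fun l _ => ?_
    refine (lintegral_mono_set Set.inter_subset_right).trans ?_
    refine (lintegral_congr_ae (ae_restrict_of_ae ?_)).le
    filter_upwards [hv l] with k hk
    rw [← hk]
    simp [AddSubgroup.vadd_def, add_comm]
  · intro l hl
    have : ((Equiv.neg (dualLattice b)) l +ᵥ K) ∩ halfOpenCell b = ∅ := by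
      ext k
      simp only [Set.mem_inter_iff, Set.mem_empty_iff_false, iff_false, not_and]
      intro h1 h2
      apply hl
      simp only [Set.Finite.mem_toFinset, Set.mem_ofPred_eq]
      refine ⟨k, h2, ?_⟩
      rw [Set.mem_vadd_set_iff_neg_vadd_mem] at h1
      simpa [AddSubgroup.vadd_def, add_comm] using h1
    rw [this]
    simp

lemma isFiniteMeasure_restrict_dualCell (b : Module.Basis (Fin d) ℝ (Eu d)) :
    IsFiniteMeasure (volume.restrict (dualCell b)) :=
  ⟨by simpa using (isCompact_dualCell b).measure_lt_top⟩

/-- Local `L²` norms of periodic functions are controlled by the norm on the cell. -/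
lemma exists_integral_sq_le {K : Set (Eu d)} (hK : IsCompact K)
    (b : Module.Basis (Fin d) ℝ (Eu d)) :
    ∃ N : ℕ, ∀ v : Eu d → ℂ, AEPeriodic b v → AEStronglyMeasurable v volume →
      MemLp v 2 (volume.restrict (dualCell b)) →
        MemLp v 2 (volume.restrict K) ∧
        ∫ k in K, ‖v k‖ ^ 2 ≤ N * ∫ k in dualCell b, ‖v k‖ ^ 2 := by
  obtain ⟨N, hN⟩ := exists_lintegral_le hK b
  refine ⟨N, fun v hv hm hL => ?_⟩
  have h1 := hN (fun k => ENNReal.ofReal (‖v k‖ ^ 2)) fun l => by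
    filter_upwards [hv l] with k hk
    rw [hk]
  have i1 := integrable_norm_sq_of_memLp hL
  rw [← ofReal_integral_eq_lintegral_ofReal i1 (Eventually.of_forall fun _ => by positivity)] at h1
  have hlt : ∫⁻ k in K, ENNReal.ofReal (‖v k‖ ^ 2) < ⊤ :=
    h1.trans_lt (ENNReal.mul_lt_top (by simp) (by simp))
  have i2 : Integrable (fun k => ‖v k‖ ^ 2) (volume.restrict K) := by
    refine ⟨(hm.restrict.norm.pow 2), ?_⟩
    rw [hasFiniteIntegral_iff_ofReal (Eventually.of_forall fun _ => by positivity)]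
    exact hlt
  refine ⟨(memLp_two_iff_integrable_sq_norm hm.restrict).2 i2, ?_⟩
  rw [← ofReal_integral_eq_lintegral_ofReal i2 (Eventually.of_forall fun _ => by positivity),
    ← ENNReal.ofReal_natCast, ← ENNReal.ofReal_mul (by positivity)] at h1
  exact (ENNReal.ofReal_le_ofReal_iff (by positivity)).1 h1

lemma AEPeriodic.memL2loc {v : Eu d → ℂ} (hv : AEPeriodic b v) (hm : AEStronglyMeasurable v volume)
    (hL : MemLp v 2 (volume.restrict (dualCell b))) : MemL2loc v :=
  ⟨hm, fun K hK => by
    obtain ⟨N, hN⟩ := exists_integral_sq_le hK b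
    exact (hN v hv hm hL).1⟩

/-- Extension of a function on the cell to a periodic function. -/
lemma exists_periodic_extension {g : Eu d → ℂ} (hg : MemLp g 2 (volume.restrict (dualCell b))) :
    ∃ G : Eu d → ℂ, (∀ k, ∀ l : dualLattice b, G (k + l) = G k) ∧
      G =ᵐ[volume.restrict (dualCell b)] g ∧ MemL2loc G := by
  -- The strongly measurable representative of `g` is used because it can be composed with the
  -- measurable map `cellRep`.
  have hper : ∀ k, ∀ l : dualLattice b, hg.1.mk g (cellRep b (k + l)) = hg.1.mk g (cellRep b k) :=
    fun k l => by rw [cellRep_add]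
  have heq : (fun k => hg.1.mk g (cellRep b k)) =ᵐ[volume.restrict (dualCell b)] g := by
    have h1 := ae_restrict_mem (μ := (volume : Measure (Eu d))) (measurableSet_halfOpenCell b)
    rw [← restrict_dualCell] at h1
    filter_upwards [hg.1.ae_eq_mk, h1] with k hk hk'
    rw [cellRep_eq_self b hk', hk]
  refine ⟨fun k => hg.1.mk g (cellRep b k), hper, heq, ?_⟩
  refine AEPeriodic.memL2loc (b := b) (fun l => Eventually.of_forall fun k => hper k l)
    (hg.1.stronglyMeasurable_mk.comp_measurable (measurable_cellRep b)).aestronglyMeasurable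
    ((memLp_congr_ae heq).2 hg)

/-- Unfolding of integrals of periodic functions against compactly supported functions. -/
lemma exists_integral_eq_sum {φ : Eu d → ℂ} (hφ : Continuous φ) (hc : HasCompactSupport φ)
    (b : Module.Basis (Fin d) ℝ (Eu d)) :
    ∃ S : Finset (dualLattice b), ∀ v : Eu d → ℂ, AEPeriodic b v → LocallyIntegrable v volume →
      ∫ k, φ k * v k = ∑ l ∈ S, ∫ k in dualCell b, φ (k + l) * v k := by
  classical
  refine ⟨(finite_translates b (K := tsupport φ) hc).toFinset, fun v hv hL => ?_⟩
  rw [restrict_dualCell, (isAddFundamentalDomain_halfOpenCell b).integral_eq_tsum'' _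
    (integrable_mul_of_compactSupport hφ hc hL),
    tsum_eq_sum (s := (finite_translates b (K := tsupport φ) hc).toFinset)]
  · refine Finset.sum_congr rfl fun l _ => ?_
    refine integral_congr_ae (ae_restrict_of_ae ?_)
    filter_upwards [hv l] with k hk
    rw [← hk]
    simp [AddSubgroup.vadd_def, add_comm]
  · intro l hl
    refine setIntegral_eq_zero_of_forall_eq_zero fun k hk => ?_
    have : φ (l +ᵥ k) = 0 := by
      by_contra h
      apply hl
      simp only [Set.Finite.mem_toFinset, Set.mem_ofPred_eq]
      refine ⟨k, hk, subset_tsupport _ ?_⟩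
      simpa [AddSubgroup.vadd_def, add_comm] using h
    rw [this, zero_mul]

/-- A translate of `v` is a weak derivative of the same function `u`, so uniqueness applies. As
uniqueness holds only almost everywhere, derivatives are merely a.e. periodic even when `u` is
periodic everywhere. -/
lemma HasWeakPartial.aePeriodic {j : Fin d} {u v : Eu d → ℂ} (h : HasWeakPartial j u v)
    (hu : ∀ k, ∀ l : dualLattice b, u (k + l) = u k) : AEPeriodic b v := by
  intro l
  have h1 := h.comp_add_right (l : Eu d)
  simp only [hu] at h1
  exact h1.ae_eq h

end DualLattice

/-! ### Compactness of bounded periodic sequences in W^{1,2}. -/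

section Compactness

variable {d : ℕ} {b : Module.Basis (Fin d) ℝ (Eu d)}

/-- Unfolding turns the integral over ℝ^d into a finite sum of integrals over one cell; the set of
translates depends on φ but not on `n`, so weak convergence on the cell applies termwise. -/
lemma WeaklyTendsto.tendsto_integral_of_periodic {v : ℕ → Eu d → ℂ} {w : Eu d → ℂ}
    (h : WeaklyTendsto (volume.restrict (dualCell b)) v w) (hv : ∀ n, AEPeriodic b (v n))
    (hvL : ∀ n, LocallyIntegrable (v n) volume) (hw : AEPeriodic b w)
    (hwL : LocallyIntegrable w volume) {φ : Eu d → ℂ} (hφ : Continuous φ)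
    (hc : HasCompactSupport φ) :
    Tendsto (fun n => ∫ k, φ k * v n k) atTop (𝓝 (∫ k, φ k * w k)) := by
  obtain ⟨S, hS⟩ := exists_integral_eq_sum hφ hc b
  simp only [hS _ (hv _) (hvL _), hS _ hw hwL]
  refine tendsto_finsetSum _ fun l _ => h _ ?_
  exact (memL2loc_of_continuous (by fun_prop)).2 _ (isCompact_dualCell b)

/-- The defining identity of a weak derivative is linear in both functions and therefore passes to
distributional limits. -/
lemma hasWeakPartial_of_tendsto {u v : ℕ → Eu d → ℂ} {u' v' : Eu d → ℂ} {j : Fin d}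
    (h : ∀ n, HasWeakPartial j (u n) (v n)) (hu' : LocallyIntegrable u' volume)
    (hv' : LocallyIntegrable v' volume)
    (hu : ∀ φ : Eu d → ℂ, Continuous φ → HasCompactSupport φ →
      Tendsto (fun n => ∫ k, φ k * u n k) atTop (𝓝 (∫ k, φ k * u' k)))
    (hv : ∀ φ : Eu d → ℂ, Continuous φ → HasCompactSupport φ →
      Tendsto (fun n => ∫ k, φ k * v n k) atTop (𝓝 (∫ k, φ k * v' k))) :
    HasWeakPartial j u' v' := by
  refine ⟨hu', hv', fun φ hφ hc => ?_⟩
  have h1 := hu (fun x => ((fderiv ℝ φ x (EuclideanSpace.single j 1) : ℝ) : ℂ))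
    (Complex.continuous_ofReal.comp (continuous_fderiv_apply hφ _))
    ((hasCompactSupport_fderiv_apply hc _).comp_left (g := fun t : ℝ => (t : ℂ)) rfl)
  have h2 := hv (fun x => ((φ x : ℝ) : ℂ)) (Complex.continuous_ofReal.comp hφ.continuous)
    (hc.comp_left (g := fun t : ℝ => (t : ℂ)) rfl)
  simp only [Complex.real_smul]
  refine tendsto_nhds_unique h1 (h2.neg.congr fun n => ?_)
  have := (h n).2.2 φ hφ hc
  simp only [Complex.real_smul] at this
  exact this.symm

lemma exists_cutoff {K : Set (Eu d)} (hK : IsCompact K) :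
    ∃ η : Eu d → ℂ, ContDiff ℝ ∞ η ∧ HasCompactSupport η ∧ ∀ x ∈ K, η x = 1 := by
  obtain ⟨R, hR⟩ := hK.isBounded.subset_closedBall 0
  let f : ContDiffBump (0 : Eu d) := ⟨|R| + 1, |R| + 2, by positivity, by linarith⟩
  refine ⟨fun x => (f x : ℂ), Complex.ofRealCLM.contDiff.comp f.contDiff,
    f.hasCompactSupport.comp_left (g := fun t : ℝ => (t : ℂ)) rfl, fun x hx => ?_⟩
  have : x ∈ Metric.closedBall (0 : Eu d) f.rIn :=
    Metric.closedBall_subset_closedBall ((le_abs_self R).trans (by simp [f])) (hR hx)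
  simp [f.one_of_mem_closedBall this]

/-- The Rellich–Kondrashov theorem for periodic functions. -/
lemma tendsto_integral_dualCell_of_weak (w : ℕ → Eu d → ℂ) (v : Fin d → ℕ → Eu d → ℂ)
    (hw : ∀ n, MemL2loc (w n)) (hv : ∀ j n, MemL2loc (v j n))
    (hwv : ∀ j n, HasWeakPartial j (w n) (v j n)) (hper : ∀ n k (l : dualLattice b),
      w n (k + l) = w n k) (C : ℝ)
    (hCw : ∀ n, ∫ x in dualCell b, ‖w n x‖ ^ 2 ≤ C)
    (hCv : ∀ j n, ∫ x in dualCell b, ‖v j n x‖ ^ 2 ≤ C)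
    (hweak : ∀ φ : Eu d → ℂ, Continuous φ → HasCompactSupport φ →
      Tendsto (fun n => ∫ x, φ x * w n x) atTop (𝓝 0)) :
    Tendsto (fun n => ∫ x in dualCell b, ‖w n x‖ ^ 2) atTop (𝓝 0) := by
  have hcell := isCompact_dualCell b
  obtain ⟨η, hη, hc, h1⟩ := exists_cutoff hcell
  -- The support of η exceeds the cell; periodicity transfers the bounds to it at the cost of the
  -- factor `N`.
  obtain ⟨N, hN⟩ := exists_integral_sq_le (K := tsupport η) hc b
  have key := tendsto_integral_cutoff_of_weak hη hc w v hw hv hwv (N * C)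
    (fun n => ((hN (w n) (fun l => Eventually.of_forall fun k => hper n k l) (hw n).1
      ((hw n).2 _ hcell)).2).trans (by gcongr; exact hCw n))
    (fun j n => ((hN (v j n) ((hwv j n).aePeriodic (hper n)) (hv j n).1
      ((hv j n).2 _ hcell)).2).trans (by gcongr; exact hCv j n)) hweak
  refine squeeze_zero (fun n => integral_nonneg fun x => by positivity) (fun n => ?_) key
  obtain ⟨M, hM⟩ := hc.exists_bound_of_continuous hη.continuous
  have h_int : Integrable (fun x => ‖η x * w n x‖ ^ 2) volume :=
    integrable_norm_sq_of_memLp (cutoff_bounds (K := tsupport η) hc hη.continuous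
      (fun x hx => image_eq_zero_of_notMem_tsupport hx) hM (hw n)).1
  calc ∫ x in dualCell b, ‖w n x‖ ^ 2 = ∫ x in dualCell b, ‖η x * w n x‖ ^ 2 :=
        setIntegral_congr_fun hcell.measurableSet fun x hx => by simp [h1 x hx]
    _ ≤ ∫ x, ‖η x * w n x‖ ^ 2 :=
        setIntegral_le_integral h_int (Eventually.of_forall fun x => by positivity)

/-- Summing the squared norms over the finite index set gives one sequence tending to zero in L¹, so
a single subsequence serves all indices. -/
lemma exists_subseq_tendsto_ae {X : Type*} [MeasurableSpace X] {μ : Measure X} {ι : Type*}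
    [Finite ι] {w : ι → ℕ → X → ℂ} (hw : ∀ i n, MemLp (w i n) 2 μ)
    (h : ∀ i, Tendsto (fun n => ∫ x, ‖w i n x‖ ^ 2 ∂μ) atTop (𝓝 0)) :
    ∃ φ : ℕ → ℕ, StrictMono φ ∧
      ∀ᵐ x ∂μ, ∀ i, Tendsto (fun n => w i (φ n) x) atTop (𝓝 0) := by
  have := Fintype.ofFinite ι
  let f : ℕ → X → ℝ := fun n x => ∑ i, ‖w i n x‖ ^ 2
  have hf : ∀ n, Integrable (f n) μ := fun n =>
    integrable_finsetSum _ fun i _ => integrable_norm_sq_of_memLp (hw i n)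
  have h1 : Tendsto (fun n => ∫ x, f n x ∂μ) atTop (𝓝 0) := by
    have := tendsto_finsetSum Finset.univ fun i _ => h i
    simp only [Finset.sum_const_zero] at this
    refine this.congr fun n => ?_
    rw [integral_finsetSum _ fun i _ => integrable_norm_sq_of_memLp (hw i n)]
  have h2 : Tendsto (fun n => eLpNorm (f n - 0) 1 μ) atTop (𝓝 0) := by
    have h3 := ENNReal.tendsto_ofReal h1
    rw [ENNReal.ofReal_zero] at h3
    refine h3.congr fun n => ?_
    rw [sub_zero, eLpNorm_one_eq_lintegral_enorm, ofReal_integral_eq_lintegral_ofReal (hf n)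
      (Eventually.of_forall fun x => Finset.sum_nonneg fun i _ => by positivity)]
    refine lintegral_congr fun x => ?_
    rw [Real.enorm_of_nonneg (Finset.sum_nonneg fun i _ => by positivity)]
  obtain ⟨φ, hφ, hae⟩ := (tendstoInMeasure_of_tendsto_eLpNorm one_ne_zero (fun n => (hf n).1)
    aestronglyMeasurable_zero h2).exists_seq_tendsto_ae
  refine ⟨φ, hφ, ?_⟩
  filter_upwards [hae] with x hx i
  have h4 : Tendsto (fun n => ‖w i (φ n) x‖ ^ 2) atTop (𝓝 0) :=
    squeeze_zero (fun n => by positivity)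
      (fun n => Finset.single_le_sum (f := fun i => ‖w i (φ n) x‖ ^ 2)
        (fun i _ => by positivity) (Finset.mem_univ i)) hx
  have h5 := h4.sqrt
  simp only [Real.sqrt_sq (norm_nonneg _), Real.sqrt_zero] at h5
  exact tendsto_zero_iff_norm_tendsto_zero.2 h5

/-- Compactness of bounded sequences of periodic functions in `W^{1,2}`. -/
theorem exists_subseq_periodic {ι : Type*} [Finite ι] (u : ι → ℕ → Eu d → ℂ)
    (v : ι → Fin d → ℕ → Eu d → ℂ) (hu : ∀ i n, MemL2loc (u i n))
    (hv : ∀ i j n, MemL2loc (v i j n)) (huv : ∀ i j n, HasWeakPartial j (u i n) (v i j n))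
    (hper : ∀ i n k (l : dualLattice b), u i n (k + l) = u i n k) (C : ℝ)
    (hCu : ∀ i n, ∫ x in dualCell b, ‖u i n x‖ ^ 2 ≤ C)
    (hCv : ∀ i j n, ∫ x in dualCell b, ‖v i j n x‖ ^ 2 ≤ C) :
    ∃ φ : ℕ → ℕ, StrictMono φ ∧ ∃ (u' : ι → Eu d → ℂ) (v' : ι → Fin d → Eu d → ℂ),
      (∀ i, MemL2loc (u' i)) ∧ (∀ i j, MemL2loc (v' i j)) ∧
      (∀ i j, HasWeakPartial j (u' i) (v' i j)) ∧
      (∀ᵐ k : Eu d, ∀ i, Tendsto (fun n => u i (φ n) k) atTop (𝓝 (u' i k))) ∧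
      ∀ i j, WeaklyTendsto (volume.restrict (dualCell b)) (fun n => v i j (φ n)) (v' i j) := by
  have hcell := isCompact_dualCell b
  have hfin := isFiniteMeasure_restrict_dualCell b
  set μ := volume.restrict (dualCell b) with hμ
  -- Functions and their derivatives form one family over a sum type, so that one extraction handles
  -- all of them.
  obtain ⟨φ, hφ, g, hg⟩ := exists_weaklyTendsto_subseq_finite (μ := μ)
    (ι := ι ⊕ (ι × Fin d)) (fun s n => Sum.elim (fun i => u i n) (fun p => v p.1 p.2 n) s)
    (fun s n => by
      rcases s with i | p
      · exact (hu i n).2 _ hcell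
      · exact (hv p.1 p.2 n).2 _ hcell) C
    (fun s n => by
      rcases s with i | p
      · exact hCu i n
      · exact hCv p.1 p.2 n)
  choose u' hu'per hu'eq hu' using fun i => exists_periodic_extension (hg (Sum.inl i)).1
  choose v' hv'per hv'eq hv' using fun i j => exists_periodic_extension (hg (Sum.inr (i, j))).1
  have wu : ∀ i, WeaklyTendsto μ (fun n => u i (φ n)) (u' i) := fun i f hf => by
    have h1 := (hg (Sum.inl i)).2 f hf
    have h2 : ∫ x, f x * g (Sum.inl i) x ∂μ = ∫ x, f x * u' i x ∂μ := by
      refine integral_congr_ae ?_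
      filter_upwards [hu'eq i] with x hx
      rw [hx]
    rwa [h2] at h1
  have wv : ∀ i j, WeaklyTendsto μ (fun n => v i j (φ n)) (v' i j) := fun i j f hf => by
    have h1 := (hg (Sum.inr (i, j))).2 f hf
    have h2 : ∫ x, f x * g (Sum.inr (i, j)) x ∂μ = ∫ x, f x * v' i j x ∂μ := by
      refine integral_congr_ae ?_
      filter_upwards [hv'eq i j] with x hx
      rw [hx]
    rwa [h2] at h1
  have pu : ∀ i n, AEPeriodic b (u i n) := fun i n l => Eventually.of_forall fun k => hper i n k l
  have pu' : ∀ i, AEPeriodic b (u' i) := fun i l => Eventually.of_forall fun k => hu'per i k l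
  have pv' : ∀ i j, AEPeriodic b (v' i j) := fun i j l =>
    Eventually.of_forall fun k => hv'per i j k l
  have tu : ∀ i (f : Eu d → ℂ), Continuous f → HasCompactSupport f →
      Tendsto (fun n => ∫ k, f k * u i (φ n) k) atTop (𝓝 (∫ k, f k * u' i k)) :=
    fun i f hf hc => (wu i).tendsto_integral_of_periodic (fun n => pu i _)
      (fun n => (hu i _).locallyIntegrable) (pu' i) (hu' i).locallyIntegrable hf hc
  have tv : ∀ i j (f : Eu d → ℂ), Continuous f → HasCompactSupport f →
      Tendsto (fun n => ∫ k, f k * v i j (φ n) k) atTop (𝓝 (∫ k, f k * v' i j k)) :=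
    fun i j f hf hc => (wv i j).tendsto_integral_of_periodic
      (fun n => (huv i j _).aePeriodic (hper i _))
      (fun n => (hv i j _).locallyIntegrable) (pv' i j) (hv' i j).locallyIntegrable hf hc
  have huv' : ∀ i j, HasWeakPartial j (u' i) (v' i j) := fun i j =>
    hasWeakPartial_of_tendsto (fun n => huv i j (φ n)) (hu' i).locallyIntegrable
      (hv' i j).locallyIntegrable (tu i) (tv i j)
  have sq_sub : ∀ {f f' : Eu d → ℂ}, MemL2loc f → MemL2loc f' →
      ∫ x in dualCell b, ‖f x - f' x‖ ^ 2
        ≤ 2 * (∫ x in dualCell b, ‖f x‖ ^ 2) + 2 * ∫ x in dualCell b, ‖f' x‖ ^ 2 := by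
    intro f f' hf hf'
    have i1 := (integrable_norm_sq_of_memLp (hf.2 _ hcell)).const_mul 2
    have i2 := (integrable_norm_sq_of_memLp (hf'.2 _ hcell)).const_mul 2
    rw [← integral_const_mul, ← integral_const_mul, ← integral_add i1 i2]
    refine integral_mono (integrable_norm_sq_of_memLp ((hf.sub hf').2 _ hcell)) (i1.add i2)
      fun x => ?_
    have := norm_sub_le (f x) (f' x)
    nlinarith [sq_nonneg (‖f x‖ - ‖f' x‖), norm_nonneg (f x - f' x)]
  -- Rellich is applied to the differences from the weak limit, which tend weakly to zero and have
  -- bounded derivatives.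
  have hstrong : ∀ i, Tendsto (fun n => ∫ x in dualCell b, ‖u i (φ n) x - u' i x‖ ^ 2)
      atTop (𝓝 0) := by
    intro i
    set D : ℝ := (∫ x in dualCell b, ‖u' i x‖ ^ 2) + ∑ j, ∫ x in dualCell b, ‖v' i j x‖ ^ 2
    have nn : ∀ f : Eu d → ℂ, 0 ≤ ∫ x in dualCell b, ‖f x‖ ^ 2 := fun f =>
      integral_nonneg fun x => by positivity
    refine tendsto_integral_dualCell_of_weak (b := b) (fun n x => u i (φ n) x - u' i x)
      (fun j n x => v i j (φ n) x - v' i j x) (fun n => (hu i _).sub (hu' i))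
      (fun j n => (hv i j _).sub (hv' i j)) (fun j n => (huv i j _).sub (huv' i j))
      (fun n k l => by rw [hper, hu'per]) (2 * C + 2 * D) (fun n => ?_) (fun j n => ?_) ?_
    · refine (sq_sub (hu i _) (hu' i)).trans ?_
      gcongr
      · exact hCu i _
      · exact le_add_of_nonneg_right (Finset.sum_nonneg fun j _ => nn _)
    · refine (sq_sub (hv i j _) (hv' i j)).trans ?_
      gcongr
      · exact hCv i j _
      · exact (Finset.single_le_sum (f := fun j => ∫ x in dualCell b, ‖v' i j x‖ ^ 2)
          (fun j _ => nn _) (Finset.mem_univ j)).trans (le_add_of_nonneg_left (nn _))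
    · intro f hf hc
      have h1 := (tu i f hf hc).sub_const (∫ k, f k * u' i k)
      rw [sub_self] at h1
      refine h1.congr fun n => ?_
      rw [← integral_sub (integrable_mul_of_compactSupport hf hc (hu i _).locallyIntegrable)
        (integrable_mul_of_compactSupport hf hc (hu' i).locallyIntegrable)]
      simp only [mul_sub]
  obtain ⟨ψ, hψ, hae⟩ := exists_subseq_tendsto_ae (μ := μ)
    (w := fun i n x => u i (φ n) x - u' i x)
    (fun i n => ((hu i _).sub (hu' i)).2 _ hcell) hstrong
  refine ⟨φ ∘ ψ, hφ.comp hψ, u', v', hu', hv', huv', ?_, fun i j => (wv i j).comp hψ.tendsto_atTop⟩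
  refine ae_of_ae_dualCell (b := b) (fun k l => ?_) ?_
  · simp only [hper, hu'per]
  · filter_upwards [hae] with x hx i
    have := (hx i).add_const (u' i x)
    simpa using this

end Compactness

/-! ### Pointwise algebra of the energy density and its gauge transformation. -/

section MatrixIdentities

variable {m : ℕ}

/-- The matrices `Uᴴ (V + A U)`. -/
def covariantPart (A u v : Matrix (Fin m) (Fin m) ℂ) : Matrix (Fin m) (Fin m) ℂ :=
  uᴴ * (v + A * u)

/-- The linear part `tr((U Vᴴ - V Uᴴ) A)` of the energy density. -/
def crossTerm (A u v : Matrix (Fin m) (Fin m) ℂ) : ℂ := ((u * vᴴ - v * uᴴ) * A).trace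

/-- The energy density. -/
def energyDensity (A u v : Matrix (Fin m) (Fin m) ℂ) : ℝ :=
  ((vᴴ * v).trace + crossTerm A u v).re

lemma re_trace_conjTranspose_mul_self (v : Matrix (Fin m) (Fin m) ℂ) :
    (vᴴ * v).trace.re = ∑ p, ∑ q, ‖v p q‖ ^ 2 := by
  rw [Finset.sum_comm]
  simp [Matrix.trace, Matrix.mul_apply, Complex.sq_norm, Complex.normSq_apply]

lemma re_trace_conjTranspose (x : Matrix (Fin m) (Fin m) ℂ) : xᴴ.trace.re = x.trace.re := by
  simp [Matrix.trace_conjTranspose]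

/-- Re tr x* = Re tr x folds both halves into one pairing with `v`. Only A - A* enters, so the
argument never needs `A` to be anti-Hermitian. -/
lemma crossTerm_re (A u v : Matrix (Fin m) (Fin m) ℂ) :
    (crossTerm A u v).re = (vᴴ * ((A - Aᴴ) * u)).trace.re := by
  have h1 : (v * uᴴ * A).trace.re = (vᴴ * (Aᴴ * u)).trace.re := by
    rw [← re_trace_conjTranspose, Matrix.conjTranspose_mul, Matrix.conjTranspose_mul,
      Matrix.conjTranspose_conjTranspose, ← Matrix.mul_assoc, Matrix.trace_mul_comm]
  have h2 : (u * vᴴ * A).trace = (vᴴ * (A * u)).trace := by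
    rw [Matrix.mul_assoc, Matrix.trace_mul_comm, Matrix.mul_assoc]
  rw [crossTerm, Matrix.sub_mul, Matrix.trace_sub, Complex.sub_re, h1, h2, Matrix.sub_mul,
    Matrix.mul_sub, Matrix.trace_sub, Complex.sub_re]

lemma energyDensity_eq (A u v : Matrix (Fin m) (Fin m) ℂ) :
    energyDensity A u v = (vᴴ * v).trace.re + (vᴴ * ((A - Aᴴ) * u)).trace.re := by
  rw [energyDensity, Complex.add_re, crossTerm_re]

/-- With B = A - A*, the square ‖v + 2Bu‖² ≥ 0 bounds the cross term below by -‖v‖²/4 - ‖B‖², where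
‖Bu‖ = ‖B‖ by unitarity. More than half of ‖v‖² is left over. -/
lemma le_energyDensity {A u v : Matrix (Fin m) (Fin m) ℂ}
    (hu : u ∈ Matrix.unitaryGroup (Fin m) ℂ) :
    (1 / 2) * (vᴴ * v).trace.re - ((A - Aᴴ)ᴴ * (A - Aᴴ)).trace.re ≤ energyDensity A u v := by
  rw [energyDensity_eq]
  set B := A - Aᴴ
  have huu : u * uᴴ = 1 := Matrix.mem_unitaryGroup_iff.1 hu
  have h0 : 0 ≤ ((v + (2 : ℂ) • (B * u))ᴴ * (v + (2 : ℂ) • (B * u))).trace.re := by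
    rw [re_trace_conjTranspose_mul_self]
    positivity
  have h1 : ((B * u)ᴴ * (B * u)).trace = (Bᴴ * B).trace := by
    rw [Matrix.conjTranspose_mul, Matrix.mul_assoc, Matrix.trace_mul_comm, Matrix.mul_assoc,
      Matrix.mul_assoc, huu, Matrix.mul_one]
  have h2 : ((B * u)ᴴ * v).trace.re = (vᴴ * (B * u)).trace.re := by
    rw [← re_trace_conjTranspose, Matrix.conjTranspose_mul, Matrix.conjTranspose_conjTranspose]
  have h3 : 0 ≤ (Bᴴ * B).trace.re := by
    rw [re_trace_conjTranspose_mul_self]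
    positivity
  have h4 : 0 ≤ (vᴴ * v).trace.re := by
    rw [re_trace_conjTranspose_mul_self]
    positivity
  have h5 : ((v + (2 : ℂ) • (B * u))ᴴ * (v + (2 : ℂ) • (B * u))).trace.re
      = (vᴴ * v).trace.re + 4 * (vᴴ * (B * u)).trace.re + 4 * (Bᴴ * B).trace.re := by
    rw [Matrix.conjTranspose_add, Matrix.conjTranspose_smul, Matrix.add_mul, Matrix.mul_add,
      Matrix.mul_add]
    simp only [Matrix.trace_add, Matrix.smul_mul, Matrix.mul_smul, Matrix.trace_smul, h1]
    rw [Matrix.conjTranspose_mul] at h2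
    simp [h2]
    ring
  linarith

variable {A u v : Matrix (Fin m) (Fin m) ℂ}

/-- The new `v` is the derivative of u·D when the diagonal phases satisfy ∂D_a = iδ_a D_a. The
transformed matrix is D*(M + iδ)D with M = u*(v + Au), and the phases cancel on its diagonal. -/
lemma covariantPart_gauge (hu : u ∈ Matrix.unitaryGroup (Fin m) ℂ) {D : Fin m → ℂ}
    (hD : ∀ a, star (D a) * D a = 1) (δ : Fin m → ℝ) (a : Fin m) :
    covariantPart A (u * Matrix.diagonal D)
      ((v + u * Matrix.diagonal fun a => Complex.I * δ a) * Matrix.diagonal D) a a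
      = covariantPart A u v a a + Complex.I * δ a := by
  have huu : uᴴ * u = 1 := Matrix.mem_unitaryGroup_iff'.1 hu
  have h : covariantPart A (u * Matrix.diagonal D)
      ((v + u * Matrix.diagonal fun a => Complex.I * δ a) * Matrix.diagonal D)
      = Matrix.diagonal (star D) * ((covariantPart A u v + Matrix.diagonal fun a => Complex.I * δ a)
        * Matrix.diagonal D) := by
    simp only [covariantPart, Matrix.conjTranspose_mul, Matrix.diagonal_conjTranspose,
      Matrix.mul_assoc, Matrix.add_mul, Matrix.mul_add]
    rw [← Matrix.mul_assoc uᴴ u, huu, Matrix.one_mul]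
    abel
  rw [h, Matrix.diagonal_mul, Matrix.mul_diagonal, Matrix.add_apply, Matrix.diagonal_apply_eq]
  have := hD a
  simp only [Pi.star_apply]
  linear_combination (covariantPart A u v a a + Complex.I * δ a) * this

/-- The increment is pointwise affine in the diagonal of u*(v + Au). After averaging it cancels Re
(z_a + iδ_a)² - Re z_a² = -2δ_a Im z_a - δ_a². -/
lemma energyDensity_gauge (hu : u ∈ Matrix.unitaryGroup (Fin m) ℂ) {D : Fin m → ℂ}
    (hD : ∀ a, star (D a) * D a = 1) (δ : Fin m → ℝ) :
    energyDensity A (u * Matrix.diagonal D)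
      ((v + u * Matrix.diagonal fun a => Complex.I * δ a) * Matrix.diagonal D)
      = energyDensity A u v + ∑ a, (2 * δ a * (covariantPart A u v a a).im + δ a ^ 2) := by
  have huu : uᴴ * u = 1 := Matrix.mem_unitaryGroup_iff'.1 hu
  have hDD : Matrix.diagonal D * (Matrix.diagonal D)ᴴ = 1 := by
    rw [Matrix.diagonal_conjTranspose, Matrix.diagonal_mul_diagonal, ← Matrix.diagonal_one]
    congr 1
    ext a
    rw [Pi.star_apply, mul_comm, hD a]
  set E : Matrix (Fin m) (Fin m) ℂ := Matrix.diagonal fun a => Complex.I * δ a with hE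
  have hEH : Eᴴ = -E := by
    ext p q
    by_cases h : p = q
    · subst h; simp [hE]
    · simp [hE, Matrix.diagonal_apply_ne _ h, Matrix.diagonal_apply_ne' _ h]
  set B := A - Aᴴ with hB
  have conj_tr : ∀ y z : Matrix (Fin m) (Fin m) ℂ,
      ((y * Matrix.diagonal D)ᴴ * (z * Matrix.diagonal D)).trace = (yᴴ * z).trace := fun y z => by
    rw [Matrix.conjTranspose_mul, Matrix.mul_assoc, Matrix.trace_mul_comm, Matrix.mul_assoc,
      Matrix.mul_assoc, hDD, Matrix.mul_one]
  rw [energyDensity_eq, energyDensity_eq, ← Matrix.mul_assoc B, conj_tr, conj_tr]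
  have dE : ∀ y : Matrix (Fin m) (Fin m) ℂ,
      (Eᴴ * y).trace.re = ∑ a, δ a * (y a a).im := fun y => by
    rw [hEH, Matrix.neg_mul, Matrix.trace_neg, Matrix.trace]
    simp [hE, Matrix.diagonal_mul]
  have t1 : ((v + u * E)ᴴ * (v + u * E)).trace.re
      = (vᴴ * v).trace.re + 2 * (Eᴴ * (uᴴ * v)).trace.re + (Eᴴ * E).trace.re := by
    have e1 : (vᴴ * (u * E)).trace.re = (Eᴴ * (uᴴ * v)).trace.re := by
      rw [← re_trace_conjTranspose]
      simp [Matrix.mul_assoc]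
    have e2 : (u * E)ᴴ * (u * E) = Eᴴ * E := by
      rw [Matrix.conjTranspose_mul, Matrix.mul_assoc, ← Matrix.mul_assoc uᴴ, huu, Matrix.one_mul]
    rw [Matrix.conjTranspose_add, Matrix.add_mul, Matrix.mul_add, Matrix.mul_add, e2]
    simp only [Matrix.trace_add, Complex.add_re, e1, Matrix.conjTranspose_mul, Matrix.mul_assoc]
    ring
  have t2 : ((v + u * E)ᴴ * (B * u)).trace.re
      = (vᴴ * (B * u)).trace.re + (Eᴴ * (uᴴ * (B * u))).trace.re := by
    rw [Matrix.conjTranspose_add, Matrix.add_mul]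
    simp only [Matrix.trace_add, Complex.add_re, Matrix.conjTranspose_mul, Matrix.mul_assoc]
  have t3 : ∀ a, ((uᴴ * (B * u)) a a).im = 2 * ((uᴴ * (A * u)) a a).im := fun a => by
    have h1 : uᴴ * (B * u) = uᴴ * (A * u) - (uᴴ * (A * u))ᴴ := by
      simp [hB, Matrix.sub_mul, Matrix.mul_sub, Matrix.mul_assoc]
    rw [h1, Matrix.sub_apply, Matrix.conjTranspose_apply]
    simp
    ring
  have t4 : ∀ a, (E a a).im = δ a := fun a => by simp [hE]
  rw [t1, t2, dE, dE, dE]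
  simp only [t3, t4, covariantPart, Matrix.mul_add, Matrix.add_apply, Complex.add_im]
  rw [Finset.sum_congr rfl (fun a _ => show 2 * δ a * (((uᴴ * v) a a).im + ((uᴴ * (A * u)) a a).im)
    + δ a ^ 2 = 2 * (δ a * ((uᴴ * v) a a).im) + δ a * δ a
      + δ a * (2 * ((uᴴ * (A * u)) a a).im) by ring), Finset.sum_add_distrib,
    Finset.sum_add_distrib, ← Finset.mul_sum]
  ring

/-- Every summand has the form bounded factor × entry of `A` × entry of `v`, the shape required by
`integrable_mul_mul` and `WeaklyTendsto.integral_mul_mul`. -/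
lemma crossTerm_expand (A u v : Matrix (Fin m) (Fin m) ℂ) :
    crossTerm A u v = (∑ p, ∑ r, ∑ q, u p q * A r p * star (v r q))
      - ∑ p, ∑ r, ∑ q, star (u r q) * A r p * v p q := by
  rw [crossTerm, Matrix.sub_mul, Matrix.trace_sub]
  simp only [Matrix.trace, Matrix.diag_apply, Matrix.mul_apply, Matrix.conjTranspose_apply,
    Finset.sum_mul]
  congr 1 <;> refine Finset.sum_congr rfl fun p _ => Finset.sum_congr rfl fun r _ =>
      Finset.sum_congr rfl fun q _ => by ring

/-- The factors 1 play the fixed L² function in the triple-product lemmas; on a finite measure space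
the constant 1 is in L². -/
lemma covariantPart_expand (A u v : Matrix (Fin m) (Fin m) ℂ) (a : Fin m) :
    covariantPart A u v a a = (∑ p, star (u p a) * 1 * v p a)
      + ∑ p, ∑ q, star (u p a) * u q a * 1 * A p q := by
  rw [covariantPart, Matrix.mul_add, Matrix.add_apply]
  simp only [Matrix.mul_apply, Matrix.conjTranspose_apply, Finset.mul_sum, mul_one]
  congr 1
  refine Finset.sum_congr rfl fun p _ => Finset.sum_congr rfl fun q _ => by ring

end MatrixIdentities

/-! ### Integrated energy: coercivity, lower semicontinuity and gauge invariance. -/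

section Energy

variable {m : ℕ} {X : Type*} [MeasurableSpace X] {μ : Measure X}

/-- Contribution of one direction to the localization functional. -/
def gaugeEnergy (μ : Measure X) (A u v : X → Matrix (Fin m) (Fin m) ℂ) : ℝ :=
  ∫ x, energyDensity (A x) (u x) (v x) ∂μ
    + ∑ a, ((∫ x, covariantPart (A x) (u x) (v x) a a ∂μ) ^ 2).re

/-- Square integrability of all matrix entries. -/
def MatrixMemL2 (μ : Measure X) (A : X → Matrix (Fin m) (Fin m) ℂ) : Prop :=
  ∀ p q, MemLp (fun x => A x p q) 2 μ

/-- Measurable maps into the unitary group. -/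
def IsUnitaryField (μ : Measure X) (u : X → Matrix (Fin m) (Fin m) ℂ) : Prop :=
  (∀ x, u x ∈ Matrix.unitaryGroup (Fin m) ℂ) ∧ ∀ p q, AEStronglyMeasurable (fun x => u x p q) μ

lemma IsUnitaryField.norm_le {u : X → Matrix (Fin m) (Fin m) ℂ} (hu : IsUnitaryField μ u) (x : X)
    (p q : Fin m) : ‖u x p q‖ ≤ 1 :=
  entry_norm_bound_of_unitary (hu.1 x) p q

lemma integrable_mul_mul {s f g : X → ℂ} (hs : AEStronglyMeasurable s μ) (hs1 : ∀ x, ‖s x‖ ≤ 1)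
    (hf : MemLp f 2 μ) (hg : MemLp g 2 μ) : Integrable (fun x => s x * f x * g x) μ := by
  have : MemLp (fun x => s x * f x) 2 μ :=
    hf.of_le (hs.mul hf.1) (Eventually.of_forall fun x => by
      rw [norm_mul]; exact mul_le_of_le_one_left (norm_nonneg _) (hs1 x))
  exact this.integrable_mul hg

variable {A u v : X → Matrix (Fin m) (Fin m) ℂ}

lemma IsUnitaryField.norm_star_mul_le (hu : IsUnitaryField μ u) (x : X) (p q r s : Fin m) :
    ‖star (u x p q) * u x r s‖ ≤ 1 := by
  rw [norm_mul, norm_star]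
  exact mul_le_one₀ (hu.norm_le x p q) (norm_nonneg _) (hu.norm_le x r s)

lemma integrable_cross_left (hu : IsUnitaryField μ u) (hA : MatrixMemL2 μ A)
    (hv : MatrixMemL2 μ v) (p r q : Fin m) :
    Integrable (fun x => u x p q * A x r p * star (v x r q)) μ :=
  integrable_mul_mul (hu.2 p q) (fun x => hu.norm_le x p q) (hA r p) (hv r q).star

lemma integrable_cross_right (hu : IsUnitaryField μ u) (hA : MatrixMemL2 μ A)
    (hv : MatrixMemL2 μ v) (p r q : Fin m) :
    Integrable (fun x => star (u x r q) * A x r p * v x p q) μ :=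
  integrable_mul_mul (hu.2 r q).star (fun x => by rw [norm_star]; exact hu.norm_le x r q)
    (hA r p) (hv p q)

lemma integrable_crossTerm (hu : IsUnitaryField μ u) (hA : MatrixMemL2 μ A)
    (hv : MatrixMemL2 μ v) : Integrable (fun x => crossTerm (A x) (u x) (v x)) μ := by
  simp only [crossTerm_expand]
  exact (integrable_finsetSum _ fun p _ => integrable_finsetSum _ fun r _ =>
    integrable_finsetSum _ fun q _ => integrable_cross_left hu hA hv p r q).sub
    (integrable_finsetSum _ fun p _ => integrable_finsetSum _ fun r _ =>
    integrable_finsetSum _ fun q _ => integrable_cross_right hu hA hv p r q)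

lemma integral_crossTerm (hu : IsUnitaryField μ u) (hA : MatrixMemL2 μ A)
    (hv : MatrixMemL2 μ v) : ∫ x, crossTerm (A x) (u x) (v x) ∂μ
      = (∑ p, ∑ r, ∑ q, ∫ x, u x p q * A x r p * star (v x r q) ∂μ)
      - ∑ p, ∑ r, ∑ q, ∫ x, star (u x r q) * A x r p * v x p q ∂μ := by
  simp only [crossTerm_expand]
  have h1 := integrable_cross_left hu hA hv
  have h2 := integrable_cross_right hu hA hv
  rw [integral_sub (integrable_finsetSum _ fun p _ => integrable_finsetSum _ fun r _ =>
    integrable_finsetSum _ fun q _ => h1 p r q) (integrable_finsetSum _ fun p _ =>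
    integrable_finsetSum _ fun r _ => integrable_finsetSum _ fun q _ => h2 p r q)]
  congr 1
  · rw [integral_finsetSum _ fun p _ => integrable_finsetSum _ fun r _ =>
      integrable_finsetSum _ fun q _ => h1 p r q]
    refine Finset.sum_congr rfl fun p _ => ?_
    rw [integral_finsetSum _ fun r _ => integrable_finsetSum _ fun q _ => h1 p r q]
    refine Finset.sum_congr rfl fun r _ => ?_
    rw [integral_finsetSum _ fun q _ => h1 p r q]
  · rw [integral_finsetSum _ fun p _ => integrable_finsetSum _ fun r _ =>
      integrable_finsetSum _ fun q _ => h2 p r q]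
    refine Finset.sum_congr rfl fun p _ => ?_
    rw [integral_finsetSum _ fun r _ => integrable_finsetSum _ fun q _ => h2 p r q]
    refine Finset.sum_congr rfl fun r _ => ?_
    rw [integral_finsetSum _ fun q _ => h2 p r q]

lemma integrable_trace_sq (hv : MatrixMemL2 μ v) :
    Integrable (fun x => ((v x)ᴴ * v x).trace) μ := by
  simp only [Matrix.trace, Matrix.diag_apply, Matrix.mul_apply, Matrix.conjTranspose_apply]
  exact integrable_finsetSum _ fun p _ => integrable_finsetSum _ fun q _ =>
    (hv q p).star.integrable_mul (hv q p)

lemma integral_re_trace_sq (hv : MatrixMemL2 μ v) :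
    ∫ x, ((v x)ᴴ * v x).trace.re ∂μ = ∑ p, ∑ q, ∫ x, ‖v x p q‖ ^ 2 ∂μ := by
  simp only [re_trace_conjTranspose_mul_self]
  rw [integral_finsetSum _ fun p _ => integrable_finsetSum _ fun q _ =>
    integrable_norm_sq_of_memLp (hv p q)]
  refine Finset.sum_congr rfl fun p _ => ?_
  rw [integral_finsetSum _ fun q _ => integrable_norm_sq_of_memLp (hv p q)]

lemma integrable_energyDensity (hu : IsUnitaryField μ u) (hA : MatrixMemL2 μ A)
    (hv : MatrixMemL2 μ v) : Integrable (fun x => energyDensity (A x) (u x) (v x)) μ :=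
  ((integrable_trace_sq hv).add (integrable_crossTerm hu hA hv)).re

lemma integral_energyDensity (hu : IsUnitaryField μ u) (hA : MatrixMemL2 μ A)
    (hv : MatrixMemL2 μ v) : ∫ x, energyDensity (A x) (u x) (v x) ∂μ
      = (∑ p, ∑ q, ∫ x, ‖v x p q‖ ^ 2 ∂μ) + (∫ x, crossTerm (A x) (u x) (v x) ∂μ).re := by
  have h1 : Integrable (fun x => ((v x)ᴴ * v x).trace.re) μ := (integrable_trace_sq hv).re
  have h2 : Integrable (fun x => (crossTerm (A x) (u x) (v x)).re) μ :=
    (integrable_crossTerm hu hA hv).re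
  simp only [energyDensity, Complex.add_re]
  rw [integral_add h1 h2, integral_re_trace_sq hv]
  congr 1
  exact integral_re (integrable_crossTerm hu hA hv)

lemma MatrixMemL2.sub {B : X → Matrix (Fin m) (Fin m) ℂ} (hA : MatrixMemL2 μ A)
    (hB : MatrixMemL2 μ B) : MatrixMemL2 μ fun x => A x - B x :=
  fun p q => (hA p q).sub (hB p q)

lemma MatrixMemL2.conjTranspose (hA : MatrixMemL2 μ A) : MatrixMemL2 μ fun x => (A x)ᴴ :=
  fun p q => (hA q p).star

/-- Coercivity of the energy when the averages of `Uᴴ (∂U + A U)` are bounded. -/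
lemma le_gaugeEnergy (hu : IsUnitaryField μ u) (hA : MatrixMemL2 μ A) (hv : MatrixMemL2 μ v)
    {R : ℝ} (hR : ∀ a, |(∫ x, covariantPart (A x) (u x) (v x) a a ∂μ).im| ≤ R) :
    (1 / 2) * (∑ p, ∑ q, ∫ x, ‖v x p q‖ ^ 2 ∂μ)
      - ∫ x, ((A x - (A x)ᴴ)ᴴ * (A x - (A x)ᴴ)).trace.re ∂μ - m * R ^ 2
      ≤ gaugeEnergy μ A u v := by
  have h1 : Integrable (fun x => (1 / 2) * ((v x)ᴴ * v x).trace.re) μ :=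
    (integrable_trace_sq hv).re.const_mul _
  have h2 : Integrable (fun x => ((A x - (A x)ᴴ)ᴴ * (A x - (A x)ᴴ)).trace.re) μ :=
    (integrable_trace_sq (hA.sub hA.conjTranspose)).re
  have h3 : (1 / 2) * (∑ p, ∑ q, ∫ x, ‖v x p q‖ ^ 2 ∂μ)
      - ∫ x, ((A x - (A x)ᴴ)ᴴ * (A x - (A x)ᴴ)).trace.re ∂μ
      ≤ ∫ x, energyDensity (A x) (u x) (v x) ∂μ := by
    rw [← integral_re_trace_sq hv, ← integral_const_mul, ← integral_sub h1 h2]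
    exact integral_mono (h1.sub h2) (integrable_energyDensity hu hA hv)
      fun x => le_energyDensity (hu.1 x)
  have h4 : -(m * R ^ 2) ≤ ∑ a, ((∫ x, covariantPart (A x) (u x) (v x) a a ∂μ) ^ 2).re := by
    have : -(m * R ^ 2) = ∑ _a : Fin m, -R ^ 2 := by simp
    rw [this]
    refine Finset.sum_le_sum fun a _ => ?_
    have h5 := hR a
    set z := ∫ x, covariantPart (A x) (u x) (v x) a a ∂μ
    have h6 : z.im ^ 2 ≤ R ^ 2 := sq_le_sq' (by linarith [abs_le.1 h5]) (abs_le.1 h5).2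
    rw [sq z, Complex.mul_re]
    -- Re z² = (Re z)² - (Im z)² ≥ -R²: only the imaginary part of the average can lower the energy.
    nlinarith [sq_nonneg z.re]
  rw [gaugeEnergy]
  linarith

lemma WeaklyTendsto.star {v : ℕ → X → ℂ} {w : X → ℂ} (h : WeaklyTendsto μ v w) :
    WeaklyTendsto μ (fun n x => star (v n x)) (fun x => star (w x)) := by
  intro g hg
  have h1 := h _ hg.star
  have h2 := (Complex.continuous_conj.tendsto _).comp h1
  have key : ∀ f : X → ℂ, ∫ x, g x * Star.star (f x) ∂μ
      = (starRingEnd ℂ) (∫ x, Star.star g x * f x ∂μ) := fun f => by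
    rw [← integral_conj]
    simp
  simp only [key]
  exact h2

section FiniteMeasure

variable [IsFiniteMeasure μ]

lemma integrable_covariant_left (hu : IsUnitaryField μ u) (hv : MatrixMemL2 μ v) (a p : Fin m) :
    Integrable (fun x => star (u x p a) * 1 * v x p a) μ :=
  integrable_mul_mul (hu.2 p a).star (fun x => by rw [norm_star]; exact hu.norm_le x p a)
    (memLp_const 1) (hv p a)

lemma integrable_covariant_right (hu : IsUnitaryField μ u) (hA : MatrixMemL2 μ A)
    (a p q : Fin m) : Integrable (fun x => star (u x p a) * u x q a * 1 * A x p q) μ :=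
  integrable_mul_mul ((hu.2 p a).star.mul (hu.2 q a)) (fun x => hu.norm_star_mul_le x p a q a)
    (memLp_const 1) (hA p q)

lemma integrable_covariantPart (hu : IsUnitaryField μ u) (hA : MatrixMemL2 μ A)
    (hv : MatrixMemL2 μ v) (a : Fin m) :
    Integrable (fun x => covariantPart (A x) (u x) (v x) a a) μ := by
  simp only [covariantPart_expand]
  exact (integrable_finsetSum _ fun p _ => integrable_covariant_left hu hv a p).add
    (integrable_finsetSum _ fun p _ => integrable_finsetSum _ fun q _ =>
      integrable_covariant_right hu hA a p q)

lemma integral_covariantPart (hu : IsUnitaryField μ u) (hA : MatrixMemL2 μ A)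
    (hv : MatrixMemL2 μ v) (a : Fin m) :
    ∫ x, covariantPart (A x) (u x) (v x) a a ∂μ
      = (∑ p, ∫ x, star (u x p a) * 1 * v x p a ∂μ)
        + ∑ p, ∑ q, ∫ x, star (u x p a) * u x q a * 1 * A x p q ∂μ := by
  simp only [covariantPart_expand]
  have h1 := integrable_covariant_left hu hv a
  have h2 := integrable_covariant_right hu hA a
  rw [integral_add (integrable_finsetSum _ fun p _ => h1 p)
    (integrable_finsetSum _ fun p _ => integrable_finsetSum _ fun q _ => h2 p q),
    integral_finsetSum _ fun p _ => h1 p,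
    integral_finsetSum _ fun p _ => integrable_finsetSum _ fun q _ => h2 p q]
  congr 1
  refine Finset.sum_congr rfl fun p _ => ?_
  rw [integral_finsetSum _ fun q _ => h2 p q]

/-- Lower semicontinuity of the energy, in the form of a convergent sequence of lower bounds. -/
lemma exists_tendsto_le_gaugeEnergy {U V : ℕ → X → Matrix (Fin m) (Fin m) ℂ}
    (hA : MatrixMemL2 μ A) (hU : ∀ n, IsUnitaryField μ (U n)) (hV : ∀ n, MatrixMemL2 μ (V n))
    (hu : IsUnitaryField μ u) (hv : MatrixMemL2 μ v) {C : ℝ}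
    (hC : ∀ p q n, ∫ x, ‖V n x p q‖ ^ 2 ∂μ ≤ C)
    (hUu : ∀ᵐ x ∂μ, ∀ p q, Tendsto (fun n => U n x p q) atTop (𝓝 (u x p q)))
    (hVv : ∀ p q, WeaklyTendsto μ (fun n x => V n x p q) (fun x => v x p q)) :
    ∃ B : ℕ → ℝ, (∀ n, B n ≤ gaugeEnergy μ A (U n) (V n)) ∧
      Tendsto B atTop (𝓝 (gaugeEnergy μ A u v)) := by
  have hUs : ∀ p q, ∀ᵐ x ∂μ, Tendsto (fun n => star (U n x p q)) atTop (𝓝 (star (u x p q))) := by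
    intro p q
    filter_upwards [hUu] with x hx
    exact (hx p q).star
  have t2 : Tendsto (fun n => ∫ x, crossTerm (A x) (U n x) (V n x) ∂μ) atTop
      (𝓝 (∫ x, crossTerm (A x) (u x) (v x) ∂μ)) := by
    simp only [integral_crossTerm (hU _) hA (hV _), integral_crossTerm hu hA hv]
    refine Tendsto.sub ?_ ?_ <;> refine tendsto_finsetSum _ fun p _ =>
      tendsto_finsetSum _ fun r _ => tendsto_finsetSum _ fun q _ => ?_
    · refine (hVv r q).star.integral_mul_mul (fun n => (hV n r q).star) (C := C)
        (fun n => by simpa using hC r q n) (fun n => (hU n).2 p q)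
        (fun n x => (hU n).norm_le x p q) ?_ (hA r p)
      filter_upwards [hUu] with x hx using hx p q
    · exact (hVv p q).integral_mul_mul (fun n => hV n p q) (hC p q) (fun n => ((hU n).2 r q).star)
        (fun n x => (norm_star _).trans_le ((hU n).norm_le x r q)) (hUs r q) (hA r p)
  have t3 : ∀ a, Tendsto (fun n => ∫ x, covariantPart (A x) (U n x) (V n x) a a ∂μ) atTop
      (𝓝 (∫ x, covariantPart (A x) (u x) (v x) a a ∂μ)) := by
    intro a
    simp only [integral_covariantPart (hU _) hA (hV _), integral_covariantPart hu hA hv]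
    refine Tendsto.add ?_ ?_
    · refine tendsto_finsetSum _ fun p _ => ?_
      exact (hVv p a).integral_mul_mul (fun n => hV n p a) (hC p a) (fun n => ((hU n).2 p a).star)
        (fun n x => (norm_star _).trans_le ((hU n).norm_le x p a)) (hUs p a) (memLp_const 1)
    · refine tendsto_finsetSum _ fun p _ => tendsto_finsetSum _ fun q _ => ?_
      -- The term without `v` fits the same limit lemma when the entry of `A` is regarded as a
      -- constant weakly convergent sequence.
      have hconst : WeaklyTendsto μ (fun _ x => A x p q) (fun x => A x p q) :=
        fun g _ => tendsto_const_nhds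
      refine hconst.integral_mul_mul (fun _ => hA p q) (fun _ => le_rfl)
        (fun n => ((hU n).2 p a).star.mul ((hU n).2 q a))
        (fun n x => (hU n).norm_star_mul_le x p a q a) ?_ (memLp_const 1)
      filter_upwards [hUs p a, hUu] with x h1 h2 using h1.mul (h2 q a)
  -- The Dirichlet term need not converge; its affine minorant at `v` does, and its limit is the
  -- Dirichlet term of `v`.
  have t1 : Tendsto (fun n => ∑ p, ∑ q, (2 * (∫ x, star (v x p q) * V n x p q ∂μ).re
      - ∫ x, ‖v x p q‖ ^ 2 ∂μ)) atTop (𝓝 (∑ p, ∑ q, ∫ x, ‖v x p q‖ ^ 2 ∂μ)) := by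
    refine tendsto_finsetSum _ fun p _ => tendsto_finsetSum _ fun q _ => ?_
    have h1 := hVv p q _ (hv p q).star
    have h2 := (((Complex.continuous_re.tendsto _).comp h1).const_mul 2).sub_const
      (∫ x, ‖v x p q‖ ^ 2 ∂μ)
    have h3 : ∫ x, (star fun x => v x p q) x * v x p q ∂μ = ((∫ x, ‖v x p q‖ ^ 2 ∂μ : ℝ) : ℂ) := by
      rw [← integral_complex_ofReal]
      refine integral_congr_ae (Eventually.of_forall fun x => ?_)
      simp [← Complex.normSq_eq_conj_mul_self, Complex.normSq_eq_norm_sq]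
    rw [h3, Complex.ofReal_re] at h2
    convert! h2 using 2
    ring
  refine ⟨fun n => (∑ p, ∑ q, (2 * (∫ x, star (v x p q) * V n x p q ∂μ).re
      - ∫ x, ‖v x p q‖ ^ 2 ∂μ)) + (∫ x, crossTerm (A x) (U n x) (V n x) ∂μ).re
      + ∑ a, ((∫ x, covariantPart (A x) (U n x) (V n x) a a ∂μ) ^ 2).re, fun n => ?_, ?_⟩
  · rw [gaugeEnergy, integral_energyDensity (hU n) hA (hV n)]
    refine add_le_add_left (add_le_add_left ?_ _) _
    exact Finset.sum_le_sum fun p _ => Finset.sum_le_sum fun q _ =>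
      two_mul_re_integral_sub_le (hV n p q) (hv p q)
  · rw [gaugeEnergy, integral_energyDensity hu hA hv]
    refine (t1.add ((Complex.continuous_re.tendsto _).comp t2)).add ?_
    exact tendsto_finsetSum _ fun a _ => (Complex.continuous_re.tendsto _).comp ((t3 a).pow 2)

end FiniteMeasure

section GaugeChange

variable [IsProbabilityMeasure μ] {D : X → Fin m → ℂ} {δ : Fin m → ℝ}
  {u' v' : X → Matrix (Fin m) (Fin m) ℂ}

lemma integral_covariantPart_gauge (hu : IsUnitaryField μ u) (hA : MatrixMemL2 μ A)
    (hv : MatrixMemL2 μ v) (hD : ∀ x a, star (D x a) * D x a = 1)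
    (hu' : ∀ᵐ x ∂μ, u' x = u x * Matrix.diagonal (D x))
    (hv' : ∀ᵐ x ∂μ, v' x = (v x + u x * Matrix.diagonal fun a => Complex.I * δ a)
      * Matrix.diagonal (D x)) (a : Fin m) :
    ∫ x, covariantPart (A x) (u' x) (v' x) a a ∂μ
      = ∫ x, covariantPart (A x) (u x) (v x) a a ∂μ + Complex.I * δ a := by
  have h1 : ∫ x, covariantPart (A x) (u' x) (v' x) a a ∂μ
      = ∫ x, (covariantPart (A x) (u x) (v x) a a + Complex.I * δ a) ∂μ := by
    refine integral_congr_ae ?_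
    filter_upwards [hu', hv'] with x h1 h2
    rw [h1, h2, covariantPart_gauge (hu.1 x) (hD x)]
  rw [h1, integral_add (integrable_covariantPart hu hA hv a) (integrable_const _)]
  simp

/-- Invariance of the energy under diagonal changes of gauge by characters. -/
lemma gaugeEnergy_gauge (hu : IsUnitaryField μ u) (hA : MatrixMemL2 μ A)
    (hv : MatrixMemL2 μ v) (hD : ∀ x a, star (D x a) * D x a = 1)
    (hu' : ∀ᵐ x ∂μ, u' x = u x * Matrix.diagonal (D x))
    (hv' : ∀ᵐ x ∂μ, v' x = (v x + u x * Matrix.diagonal fun a => Complex.I * δ a)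
      * Matrix.diagonal (D x)) :
    gaugeEnergy μ A u' v' = gaugeEnergy μ A u v := by
  have i1 : ∀ a, Integrable (fun x => 2 * δ a * (covariantPart (A x) (u x) (v x) a a).im) μ :=
    fun a => (integrable_covariantPart hu hA hv a).im.const_mul _
  have h1 : ∫ x, energyDensity (A x) (u' x) (v' x) ∂μ = ∫ x, energyDensity (A x) (u x) (v x) ∂μ
      + ∑ a, (2 * δ a * (∫ x, covariantPart (A x) (u x) (v x) a a ∂μ).im + δ a ^ 2) := by
    have h2 : ∫ x, energyDensity (A x) (u' x) (v' x) ∂μ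
        = ∫ x, (energyDensity (A x) (u x) (v x)
          + ∑ a, (2 * δ a * (covariantPart (A x) (u x) (v x) a a).im + δ a ^ 2)) ∂μ := by
      refine integral_congr_ae ?_
      filter_upwards [hu', hv'] with x h1 h2
      rw [h1, h2, energyDensity_gauge (hu.1 x) (hD x)]
    have i2 : ∀ a, Integrable (fun x => 2 * δ a * (covariantPart (A x) (u x) (v x) a a).im
        + δ a ^ 2) μ := fun a => (i1 a).add (integrable_const _)
    rw [h2, integral_add (integrable_energyDensity hu hA hv)
      (integrable_finsetSum _ fun a _ => i2 a), integral_finsetSum _ fun a _ => i2 a]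
    congr 1
    refine Finset.sum_congr rfl fun a _ => ?_
    have h3 : ∫ x, (covariantPart (A x) (u x) (v x) a a).im ∂μ
        = (∫ x, covariantPart (A x) (u x) (v x) a a ∂μ).im :=
      integral_im (integrable_covariantPart hu hA hv a)
    have h4 : ∫ x, (2 * δ a * (covariantPart (A x) (u x) (v x) a a).im + δ a ^ 2) ∂μ
        = ∫ x, 2 * δ a * (covariantPart (A x) (u x) (v x) a a).im ∂μ + ∫ _x, δ a ^ 2 ∂μ :=
      integral_add (i1 a) (integrable_const _)
    rw [← h3, ← integral_const_mul]
    exact h4.trans (by simp)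
  rw [gaugeEnergy, gaugeEnergy, h1, add_assoc, ← Finset.sum_add_distrib]
  congr 1
  refine Finset.sum_congr rfl fun a _ => ?_
  rw [integral_covariantPart_gauge hu hA hv hD hu' hv' a]
  simp [sq]
  ring

end GaugeChange

end Energy

/-! ### The normalized measure on the cell. -/

section CellMeasure

variable {d : ℕ} (b : Module.Basis (Fin d) ℝ (Eu d))

/-- The normalized measure on the fundamental cell of the dual lattice. -/
def cellMeasure : Measure (Eu d) :=
  (volume.restrict (dualCell b) Set.univ)⁻¹ • volume.restrict (dualCell b)

lemma setAverage_eq_cellMeasure (f : Eu d → ℂ) :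
    ⨍ k in dualCell b, f k = ∫ k, f k ∂(cellMeasure b) := rfl

lemma restrict_univ_ne_zero : volume.restrict (dualCell b) Set.univ ≠ 0 := by
  simpa using volume_dualCell_ne_zero b

lemma restrict_univ_ne_top : volume.restrict (dualCell b) Set.univ ≠ ⊤ := by
  simpa using (isCompact_dualCell b).measure_lt_top.ne

instance : IsProbabilityMeasure (cellMeasure b) :=
  ⟨by rw [cellMeasure, Measure.smul_apply, smul_eq_mul,
    ENNReal.inv_mul_cancel (restrict_univ_ne_zero b) (restrict_univ_ne_top b)]⟩

lemma ae_cellMeasure {p : Eu d → Prop} (h : ∀ᵐ k ∂(volume.restrict (dualCell b)), p k) :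
    ∀ᵐ k ∂(cellMeasure b), p k :=
  Measure.ae_smul_measure h _

lemma ae_cellMeasure_of_ae {p : Eu d → Prop} (h : ∀ᵐ k : Eu d, p k) :
    ∀ᵐ k ∂(cellMeasure b), p k :=
  ae_cellMeasure b (ae_restrict_of_ae h)

lemma MemL2loc.memLp_cellMeasure {F : Type*} [NormedAddCommGroup F] {u : Eu d → F}
    (hu : MemL2loc u) : MemLp u 2 (cellMeasure b) :=
  (hu.2 _ (isCompact_dualCell b)).smul_measure (ENNReal.inv_ne_top.2 (restrict_univ_ne_zero b))

lemma MemL2loc.aestronglyMeasurable_cellMeasure {F : Type*} [NormedAddCommGroup F] {u : Eu d → F}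
    (hu : MemL2loc u) : AEStronglyMeasurable u (cellMeasure b) :=
  (hu.memLp_cellMeasure b).1

lemma integral_cellMeasure {F : Type*} [NormedAddCommGroup F] [NormedSpace ℝ F] (f : Eu d → F) :
    ∫ k, f k ∂(cellMeasure b)
      = (volume.restrict (dualCell b) Set.univ)⁻¹.toReal • ∫ k in dualCell b, f k := by
  rw [cellMeasure, integral_smul_measure]

lemma setIntegral_dualCell (f : Eu d → ℝ) :
    ∫ k in dualCell b, f k
      = (volume.restrict (dualCell b) Set.univ).toReal * ∫ k, f k ∂(cellMeasure b) := by
  rw [integral_cellMeasure, smul_eq_mul, ← mul_assoc, ENNReal.toReal_inv, mul_inv_cancel₀, one_mul]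
  exact ENNReal.toReal_ne_zero.2 ⟨restrict_univ_ne_zero b, restrict_univ_ne_top b⟩

lemma WeaklyTendsto.cellMeasure {v : ℕ → Eu d → ℂ} {w : Eu d → ℂ}
    (h : WeaklyTendsto (volume.restrict (dualCell b)) v w) : WeaklyTendsto (cellMeasure b) v w := by
  intro g hg
  simp only [integral_cellMeasure]
  refine (h g ?_).const_smul _
  have h1 : volume.restrict (dualCell b)
      = (volume.restrict (dualCell b) Set.univ) • BlochMV.cellMeasure b := by
    rw [BlochMV.cellMeasure, smul_smul,
      ENNReal.mul_inv_cancel (restrict_univ_ne_zero b) (restrict_univ_ne_top b), one_smul]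
  rw [h1]
  exact hg.smul_measure (restrict_univ_ne_top b)

lemma WeaklyTendsto.congr_right {X : Type*} [MeasurableSpace X] {μ : Measure X} {v : ℕ → X → ℂ}
    {w w' : X → ℂ} (h : WeaklyTendsto μ v w) (hw : w =ᵐ[μ] w') : WeaklyTendsto μ v w' := by
  intro g hg
  have h1 : ∫ x, g x * w x ∂μ = ∫ x, g x * w' x ∂μ := by
    refine integral_congr_ae ?_
    filter_upwards [hw] with x hx
    rw [hx]
  rw [← h1]
  exact h g hg

lemma HasWeakPartial.congr_left {F : Type*} [NormedAddCommGroup F] [NormedSpace ℝ F] {j : Fin d}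
    {u u' v : Eu d → F} (h : HasWeakPartial j u v) (hu : u =ᵐ[volume] u') :
    HasWeakPartial j u' v := by
  refine ⟨h.1.congr hu, h.2.1, fun φ hφ hc => ?_⟩
  rw [← h.2.2 φ hφ hc]
  refine integral_congr_ae ?_
  filter_upwards [hu] with x hx
  rw [hx]

end CellMeasure

/-! ### Gauges, changes of gauge by characters, and coercivity. -/

section Gauge

variable {d m : ℕ} {b : Module.Basis (Fin d) ℝ (Eu d)}

lemma gaugeLift_add (U : DualTorus b → Matrix.unitaryGroup (Fin m) ℂ) (k : Eu d)
    (l : dualLattice b) : gaugeLift b U (k + l) = gaugeLift b U k := by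
  have : ((k + l : Eu d) : DualTorus b) = (k : DualTorus b) := by simp
  rw [gaugeLift, gaugeLift, this]

lemma isUnitaryField_gaugeLift {U : DualTorus b → Matrix.unitaryGroup (Fin m) ℂ}
    (hU : U ∈ gaugeSpace b m) : IsUnitaryField (cellMeasure b) (gaugeLift b U) :=
  ⟨fun _ => (U _).2, fun p q => (hU p q).1.aestronglyMeasurable_cellMeasure b⟩

lemma matrixMemL2_gaugePartial {U : DualTorus b → Matrix.unitaryGroup (Fin m) ℂ}
    (hU : U ∈ gaugeSpace b m) (j : Fin d) : MatrixMemL2 (cellMeasure b) (gaugePartial b j U) :=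
  fun p q => ((hU p q).weakPartial j).memLp_cellMeasure b

/-- The frame vectors are unit vectors almost everywhere on the cell, so Cauchy–Schwarz bounds each
entry by the norm of the derivative of χ_q. -/
lemma matrixMemL2_berry {P : Eu d → (Hf b →L[ℂ] Hf b)} {χ : Fin m → Eu d → Hf b}
    (hχ : IsBlochFrame b P χ) (hχW : ∀ a, MemWtilde b (χ a)) (j : Fin d) :
    MatrixMemL2 (cellMeasure b) (berry b χ j) := by
  intro p q
  have h1 := ((hχW q).2.2.weakPartial j).memLp_cellMeasure b
  refine h1.of_le (((hχ.1 p).1.aestronglyMeasurable_cellMeasure b).inner h1.1) ?_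
  refine ae_cellMeasure b ?_
  filter_upwards [hχ.2] with k hk
  refine (norm_inner_le_norm (𝕜 := ℂ) (χ p k) (weakPartial j (χ q) k)).trans ?_
  rw [hk.2.1.1 p, one_mul]

/-- The functional is a sum of contributions of the directions, up to a constant. -/
lemma mvFunctional_eq {P : Eu d → (Hf b →L[ℂ] Hf b)} {χ : Fin m → Eu d → Hf b}
    (hχ : IsBlochFrame b P χ) (hχW : ∀ a, MemWtilde b (χ a))
    {U : DualTorus b → Matrix.unitaryGroup (Fin m) ℂ} (hU : U ∈ gaugeSpace b m) :
    mvFunctional b χ U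
      = (∑ j, gaugeEnergy (cellMeasure b) (berry b χ j) (gaugeLift b U) (gaugePartial b j U))
        + ∑ j, (∫ k, (m : ℂ) * ∑ a, ((‖weakPartial j (χ a) k‖ ^ 2 : ℝ) : ℂ)
          ∂(cellMeasure b)).re := by
  have hu := isUnitaryField_gaugeLift hU
  have hc : ∀ j, Integrable (fun k => (m : ℂ) * ∑ a, ((‖weakPartial j (χ a) k‖ ^ 2 : ℝ) : ℂ))
      (cellMeasure b) := fun j =>
    (integrable_finsetSum _ fun a _ => (integrable_norm_sq_of_memLp
      (((hχW a).2.2.weakPartial j).memLp_cellMeasure b)).ofReal).const_mul _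
  have h1 : ∀ j, gaugeEnergy (cellMeasure b) (berry b χ j) (gaugeLift b U) (gaugePartial b j U)
      = (∫ k, ((gaugePartial b j U k)ᴴ * gaugePartial b j U k).trace ∂(cellMeasure b)).re
      + (∫ k, crossTerm (berry b χ j k) (gaugeLift b U k) (gaugePartial b j U k)
          ∂(cellMeasure b)).re
      + ∑ a, ((∫ k, covariantPart (berry b χ j k) (gaugeLift b U k) (gaugePartial b j U k) a a
          ∂(cellMeasure b)) ^ 2).re := fun j => by
    have hv := matrixMemL2_gaugePartial hU j
    rw [gaugeEnergy, integral_energyDensity hu (matrixMemL2_berry hχ hχW j) hv,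
      ← integral_re_trace_sq hv]
    congr 2
    exact integral_re (integrable_trace_sq hv)
  simp only [h1, mvFunctional, mvFormula, setAverage_eq_cellMeasure]
  rw [Complex.add_re, Complex.add_re, Complex.re_sum, Complex.re_sum, Complex.re_sum,
    Finset.sum_add_distrib, Finset.sum_add_distrib, Finset.sum_comm (s := Finset.univ (α := Fin d))
    (t := Finset.univ (α := Fin m))]
  simp only [Complex.re_sum, integral_add (integrable_trace_sq (matrixMemL2_gaugePartial hU _))
    (hc _), Complex.add_re, Finset.sum_add_distrib, crossTerm, covariantPart]
  ring

/-- The character `k ↦ exp(i k · γ)` of the dual torus, for `γ ∈ Γ`. -/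
def dualCharacter (γ : lattice b) : DualTorus b → ℂ :=
  fun y => Quotient.liftOn' y
    (fun x : Eu d => Complex.exp ((⟪x, (γ : Eu d)⟫_ℝ : ℝ) * Complex.I)) (by
      intro x y hxy
      rw [QuotientAddGroup.leftRel_apply] at hxy
      obtain ⟨n, hn⟩ := hxy _ γ.2
      have h : ⟪y, (γ : Eu d)⟫_ℝ = ⟪x, (γ : Eu d)⟫_ℝ + 2 * Real.pi * n := by
        rw [← hn, ← inner_add_left]; congr 1; abel
      refine Complex.exp_eq_exp_iff_exists_int.2 ⟨-n, ?_⟩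
      rw [h]; push_cast; ring)

lemma dualCharacter_mk (γ : lattice b) (k : Eu d) :
    dualCharacter γ (k : DualTorus b) = Complex.exp ((⟪k, (γ : Eu d)⟫_ℝ : ℝ) * Complex.I) := rfl

lemma star_exp_mul_I_mul_self (x : ℝ) :
    star (Complex.exp (x * Complex.I)) * Complex.exp (x * Complex.I) = 1 := by
  have h := Complex.norm_exp_ofReal_mul_I x
  rw [Complex.star_def, ← Complex.normSq_eq_conj_mul_self, Complex.normSq_eq_norm_sq, h]
  simp

/-- The diagonal unitary matrix of characters. -/
def diagonalGauge (γ : Fin m → lattice b) (y : DualTorus b) : Matrix.unitaryGroup (Fin m) ℂ :=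
  ⟨Matrix.diagonal fun a => dualCharacter (γ a) y, by
    rw [Matrix.mem_unitaryGroup_iff']
    induction y using QuotientAddGroup.induction_on with
    | H k =>
      rw [Matrix.star_eq_conjTranspose, Matrix.diagonal_conjTranspose,
        Matrix.diagonal_mul_diagonal, ← Matrix.diagonal_one]
      congr 1
      ext a
      rw [Pi.star_apply, dualCharacter_mk, star_exp_mul_I_mul_self]⟩

lemma gaugeLift_mul_diagonalGauge (U : DualTorus b → Matrix.unitaryGroup (Fin m) ℂ)
    (γ : Fin m → lattice b) (k : Eu d) :
    gaugeLift b (fun y => U y * diagonalGauge γ y) k = gaugeLift b U k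
      * Matrix.diagonal fun a => Complex.exp ((⟪k, (γ a : Eu d)⟫_ℝ : ℝ) * Complex.I) := rfl

lemma hasWeakPartial_mul_diagonalGauge {U : DualTorus b → Matrix.unitaryGroup (Fin m) ℂ}
    (hU : U ∈ gaugeSpace b m) (γ : Fin m → lattice b) (j : Fin d) (p a : Fin m) :
    HasWeakPartial j (fun k => gaugeLift b (fun y => U y * diagonalGauge γ y) k p a)
      (fun k => ((γ a : Eu d) j : ℂ) * Complex.I
          * Complex.exp ((⟪k, (γ a : Eu d)⟫_ℝ : ℝ) * Complex.I) * gaugeLift b U k p a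
        + Complex.exp ((⟪k, (γ a : Eu d)⟫_ℝ : ℝ) * Complex.I) * gaugePartial b j U k p a) := by
  have h1 := ((hU p a).hasWeakPartial j).smooth_mul (contDiff_exp_inner (γ a : Eu d))
  simp only [fderiv_exp_inner] at h1
  simp only [gaugeLift_mul_diagonalGauge, Matrix.mul_diagonal]
  simpa only [mul_comm (gaugeLift b U _ p a)] using! h1

lemma mul_diagonalGauge_mem {U : DualTorus b → Matrix.unitaryGroup (Fin m) ℂ}
    (hU : U ∈ gaugeSpace b m) (γ : Fin m → lattice b) :
    (fun y => U y * diagonalGauge γ y) ∈ gaugeSpace b m := by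
  intro p a
  have hE := (contDiff_exp_inner (γ a : Eu d)).continuous
  refine ⟨?_, fun j => ⟨_, ?_, hasWeakPartial_mul_diagonalGauge hU γ j p a⟩⟩
  · simp only [gaugeLift_mul_diagonalGauge, Matrix.mul_diagonal]
    simpa only [mul_comm (gaugeLift b U _ p a)] using! (hU p a).1.continuous_mul hE
  · exact ((hU p a).1.continuous_mul (continuous_const.mul hE)).add
      (((hU p a).weakPartial j).continuous_mul hE)

lemma gaugePartial_mul_diagonalGauge {U : DualTorus b → Matrix.unitaryGroup (Fin m) ℂ}
    (hU : U ∈ gaugeSpace b m) (γ : Fin m → lattice b) (j : Fin d) :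
    ∀ᵐ k ∂(cellMeasure b), gaugePartial b j (fun y => U y * diagonalGauge γ y) k
      = (gaugePartial b j U k + gaugeLift b U k
          * Matrix.diagonal fun a => Complex.I * (((γ a : Eu d) j : ℝ) : ℂ))
        * Matrix.diagonal fun a => Complex.exp ((⟪k, (γ a : Eu d)⟫_ℝ : ℝ) * Complex.I) := by
  refine ae_cellMeasure_of_ae b ?_
  have h : ∀ᵐ k : Eu d, ∀ p a, weakPartial j
      (fun k => gaugeLift b (fun y => U y * diagonalGauge γ y) k p a) k = _ :=
    ae_all_iff.2 fun p => ae_all_iff.2 fun a =>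
      (hasWeakPartial_mul_diagonalGauge hU γ j p a).weakPartial_ae_eq
  filter_upwards [h] with k hk
  ext p a
  rw [Matrix.mul_diagonal, Matrix.add_apply, Matrix.mul_diagonal]
  refine (hk p a).trans ?_
  ring

/-- Every gauge can be changed by characters, without changing the functional, so that the
averages of the diagonal entries of `Uᴴ (∂U + A U)` are bounded. -/
lemma exists_gauge_normalized {P : Eu d → (Hf b →L[ℂ] Hf b)} {χ : Fin m → Eu d → Hf b}
    (hχ : IsBlochFrame b P χ) (hχW : ∀ a, MemWtilde b (χ a))
    {U : DualTorus b → Matrix.unitaryGroup (Fin m) ℂ} (hU : U ∈ gaugeSpace b m) :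
    ∃ V ∈ gaugeSpace b m, mvFunctional b χ V = mvFunctional b χ U ∧
      ∀ j a, |(∫ k, covariantPart (berry b χ j k) (gaugeLift b V k) (gaugePartial b j V k) a a
        ∂(cellMeasure b)).im| ≤ ∑ i, ‖b i‖ := by
  -- For fixed `a` the imaginary parts for all directions form one vector of ℝ^d. A single character
  -- shifts them all at once by γ_a, so subtracting the integer part in the basis `b` leaves the
  -- fractional part, of norm at most ∑ ‖b i‖.
  let w : Fin m → Eu d := fun a => WithLp.toLp 2 fun j =>
    (∫ k, covariantPart (berry b χ j k) (gaugeLift b U k) (gaugePartial b j U k) a a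
      ∂(cellMeasure b)).im
  let γ : Fin m → lattice b := fun a =>
    -⟨(ZSpan.floor b (w a) : Eu d), (ZSpan.floor b (w a)).2⟩
  have hu := isUnitaryField_gaugeLift hU
  have hV := mul_diagonalGauge_mem hU γ
  have hD : ∀ (k : Eu d) (a : Fin m),
      star (Complex.exp ((⟪k, (γ a : Eu d)⟫_ℝ : ℝ) * Complex.I))
        * Complex.exp ((⟪k, (γ a : Eu d)⟫_ℝ : ℝ) * Complex.I) = 1 :=
    fun k a => star_exp_mul_I_mul_self _
  have hl : ∀ᵐ k ∂(cellMeasure b), gaugeLift b (fun y => U y * diagonalGauge γ y) k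
      = gaugeLift b U k
        * Matrix.diagonal fun a => Complex.exp ((⟪k, (γ a : Eu d)⟫_ℝ : ℝ) * Complex.I) :=
    Eventually.of_forall fun k => gaugeLift_mul_diagonalGauge U γ k
  refine ⟨_, hV, ?_, fun j a => ?_⟩
  · rw [mvFunctional_eq hχ hχW hU, mvFunctional_eq hχ hχW hV]
    congr 1
    refine Finset.sum_congr rfl fun j _ => ?_
    exact gaugeEnergy_gauge hu (matrixMemL2_berry hχ hχW j) (matrixMemL2_gaugePartial hU j) hD hl
      (gaugePartial_mul_diagonalGauge hU γ j)
  · rw [integral_covariantPart_gauge hu (matrixMemL2_berry hχ hχW j)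
      (matrixMemL2_gaugePartial hU j) hD hl (gaugePartial_mul_diagonalGauge hU γ j) a]
    have h1 : (ZSpan.fract b (w a)) j = (∫ k, covariantPart (berry b χ j k) (gaugeLift b U k)
        (gaugePartial b j U k) a a ∂(cellMeasure b)).im + (γ a : Eu d) j := by
      rw [ZSpan.fract_apply]
      simp [γ, w, sub_eq_add_neg]
    have h2 : ∀ z : ℂ, (z + Complex.I * (((γ a : Eu d) j : ℝ) : ℂ)).im = z.im + (γ a : Eu d) j :=
      fun z => by simp
    rw [h2, ← h1, ← Real.norm_eq_abs]
    exact (PiLp.norm_apply_le _ j).trans (ZSpan.norm_fract_le b (w a))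

/-- Coercivity of the functional, up to a change of gauge. -/
lemma exists_gauge_bounded {P : Eu d → (Hf b →L[ℂ] Hf b)} {χ : Fin m → Eu d → Hf b}
    (hχ : IsBlochFrame b P χ) (hχW : ∀ a, MemWtilde b (χ a)) :
    ∃ K : ℝ, ∀ U ∈ gaugeSpace b m, ∃ V ∈ gaugeSpace b m,
      mvFunctional b χ V = mvFunctional b χ U ∧ -K ≤ mvFunctional b χ U ∧
      ∀ j p q, ∫ k, ‖gaugePartial b j V k p q‖ ^ 2 ∂(cellMeasure b)
        ≤ 2 * (mvFunctional b χ U + K) := by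
  set R := ∑ i, ‖b i‖
  -- The constant collects the ‖A_j - A_j*‖² left by completing the square and the bound on the
  -- normalized averages, minus the gauge-independent part of the functional.
  refine ⟨(∑ j, (∫ x, ((berry b χ j x - (berry b χ j x)ᴴ)ᴴ
    * (berry b χ j x - (berry b χ j x)ᴴ)).trace.re ∂(cellMeasure b) + m * R ^ 2))
    - ∑ j, (∫ k, (m : ℂ) * ∑ a, ((‖weakPartial j (χ a) k‖ ^ 2 : ℝ) : ℂ)
          ∂(cellMeasure b)).re, fun U hU => ?_⟩
  obtain ⟨V, hV, hVU, hR⟩ := exists_gauge_normalized hχ hχW hU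
  have h1 : ∀ j, (1 / 2) * (∑ p, ∑ q, ∫ x, ‖gaugePartial b j V x p q‖ ^ 2 ∂(cellMeasure b))
      ≤ gaugeEnergy (cellMeasure b) (berry b χ j) (gaugeLift b V) (gaugePartial b j V)
        + (∫ x, ((berry b χ j x - (berry b χ j x)ᴴ)ᴴ
          * (berry b χ j x - (berry b χ j x)ᴴ)).trace.re ∂(cellMeasure b) + m * R ^ 2) :=
    fun j => by
      have := le_gaugeEnergy (isUnitaryField_gaugeLift hV) (matrixMemL2_berry hχ hχW j)
        (matrixMemL2_gaugePartial hV j) (hR j)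
      linarith
  have h2 := Finset.sum_le_sum fun j (_ : j ∈ Finset.univ) => h1 j
  rw [← Finset.mul_sum, Finset.sum_add_distrib] at h2
  have n0 : ∀ j p q, 0 ≤ ∫ x, ‖gaugePartial b j V x p q‖ ^ 2 ∂(cellMeasure b) :=
    fun j p q => integral_nonneg fun x => by positivity
  have h0 : 0 ≤ ∑ j, ∑ p, ∑ q, ∫ x, ‖gaugePartial b j V x p q‖ ^ 2 ∂(cellMeasure b) :=
    Finset.sum_nonneg fun j _ => Finset.sum_nonneg fun p _ => Finset.sum_nonneg fun q _ => n0 j p q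
  refine ⟨V, hV, hVU, by rw [← hVU, mvFunctional_eq hχ hχW hV]; linarith, fun j p q => ?_⟩
  have h3 : ∫ x, ‖gaugePartial b j V x p q‖ ^ 2 ∂(cellMeasure b)
      ≤ ∑ j, ∑ p, ∑ q, ∫ x, ‖gaugePartial b j V x p q‖ ^ 2 ∂(cellMeasure b) := by
    refine (Finset.single_le_sum (f := fun q => ∫ x, ‖gaugePartial b j V x p q‖ ^ 2
      ∂(cellMeasure b)) (fun q _ => n0 j p q) (Finset.mem_univ q)).trans ?_
    refine (Finset.single_le_sum (f := fun p => ∑ q, ∫ x, ‖gaugePartial b j V x p q‖ ^ 2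
      ∂(cellMeasure b)) (fun p _ => Finset.sum_nonneg fun q _ => n0 j p q)
      (Finset.mem_univ p)).trans ?_
    exact Finset.single_le_sum (f := fun j => ∑ p, ∑ q, ∫ x, ‖gaugePartial b j V x p q‖ ^ 2
      ∂(cellMeasure b)) (fun j _ => Finset.sum_nonneg fun p _ => Finset.sum_nonneg fun q _ =>
      n0 j p q) (Finset.mem_univ j)
  rw [← hVU, mvFunctional_eq hχ hχW hV]
  linarith

/-- The equation L L* = 1 is polynomial in the entries and their conjugates, hence closed under
entrywise limits. -/
lemma mem_unitaryGroup_of_tendsto {U : ℕ → Matrix.unitaryGroup (Fin m) ℂ}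
    {L : Matrix (Fin m) (Fin m) ℂ}
    (h : ∀ p q, Tendsto (fun n => (U n).1 p q) atTop (𝓝 (L p q))) :
    L ∈ Matrix.unitaryGroup (Fin m) ℂ := by
  rw [Matrix.mem_unitaryGroup_iff]
  ext p q
  have h1 : Tendsto (fun n => ((U n).1 * star (U n).1) p q) atTop (𝓝 ((L * star L) p q)) := by
    simp only [Matrix.mul_apply, Matrix.star_apply]
    exact tendsto_finsetSum _ fun r _ => (h p r).mul (h q r).star
  refine tendsto_nhds_unique h1 (tendsto_const_nhds.congr fun n => ?_)
  rw [Matrix.mem_unitaryGroup_iff.1 (U n).2]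

open Classical in
/-- The entrywise limit of a sequence of gauges, where it exists. -/
def limitGauge (U : ℕ → DualTorus b → Matrix.unitaryGroup (Fin m) ℂ) (y : DualTorus b) :
    Matrix.unitaryGroup (Fin m) ℂ :=
  -- Taking the limit on the torus makes the lift periodic by construction, and the default 1 keeps
  -- the values unitary at every point.
  if h : ∃ L : Matrix.unitaryGroup (Fin m) ℂ,
      ∀ p q, Tendsto (fun n => (U n y).1 p q) atTop (𝓝 (L.1 p q)) then h.choose else 1

lemma tendsto_limitGauge {U : ℕ → DualTorus b → Matrix.unitaryGroup (Fin m) ℂ} {k : Eu d}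
    {L : Fin m → Fin m → ℂ}
    (h : ∀ p q, Tendsto (fun n => gaugeLift b (U n) k p q) atTop (𝓝 (L p q))) (p q : Fin m) :
    Tendsto (fun n => gaugeLift b (U n) k p q) atTop (𝓝 (gaugeLift b (limitGauge U) k p q)) := by
  have hL : ∃ L : Matrix.unitaryGroup (Fin m) ℂ,
      ∀ p q, Tendsto (fun n => (U n (k : DualTorus b)).1 p q) atTop (𝓝 (L.1 p q)) :=
    ⟨⟨Matrix.of L, mem_unitaryGroup_of_tendsto h⟩, h⟩
  have : limitGauge U (k : DualTorus b) = hL.choose := by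
    rw [limitGauge, dif_pos hL]
  rw [gaugeLift, this]
  exact hL.choose_spec p q

/-- Supplies an element for the infimum; without it no minimizing sequence exists. -/
lemma one_mem_gaugeSpace : (fun _ => 1) ∈ gaugeSpace b m := by
  intro p q
  have h : ∀ c : ℂ, MemL2loc (fun _ : Eu d => c) := fun c =>
    memL2loc_of_continuous continuous_const
  refine ⟨h _, fun j => ⟨fun _ => 0, h 0, (h _).locallyIntegrable, (h 0).locallyIntegrable,
    fun φ hφ hc => ?_⟩⟩
  simp only [gaugeLift, smul_zero, integral_zero, neg_zero]
  -- Integration by parts against the constant 1: a derivative of a test function has integral zero.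
  have h0 := integral_mul_fderiv_eq_neg_fderiv_mul_of_integrable (𝕜 := ℝ) (μ := volume)
    (f := fun _ : Eu d => (1 : ℝ)) (g := φ) (v := EuclideanSpace.single j (1 : ℝ)) (by simp)
    (by simpa using ((continuous_fderiv_apply hφ _).integrable_of_hasCompactSupport
      (hasCompactSupport_fderiv_apply hc _) : Integrable _ volume))
    (by simpa using (hφ.continuous.integrable_of_hasCompactSupport hc : Integrable φ volume))
    (by fun_prop) (fun x _ => hφ.differentiable (by simp) x)
  rw [integral_smul_const]
  simp only [one_mul, fderiv_fun_const, Pi.zero_apply, zero_apply, zero_mul, integral_zero,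
    neg_zero] at h0
  rw [h0, zero_smul]

end Gauge

/-! ### The direct method. -/

section Minimization

variable {d m : ℕ} {b : Module.Basis (Fin d) ℝ (Eu d)}

/-- A bounded sequence of gauges has a limit gauge whose functional is at most the limit of the
values of the functional. -/
lemma exists_gauge_le_of_tendsto {P : Eu d → (Hf b →L[ℂ] Hf b)} {χ : Fin m → Eu d → Hf b}
    (hχ : IsBlochFrame b P χ) (hχW : ∀ a, MemWtilde b (χ a))
    {U : ℕ → DualTorus b → Matrix.unitaryGroup (Fin m) ℂ} (hU : ∀ n, U n ∈ gaugeSpace b m)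
    {C I : ℝ} (hC : ∀ n j p q, ∫ k, ‖gaugePartial b j (U n) k p q‖ ^ 2 ∂(cellMeasure b) ≤ C)
    (hI : Tendsto (fun n => mvFunctional b χ (U n)) atTop (𝓝 I)) :
    ∃ V ∈ gaugeSpace b m, mvFunctional b χ V ≤ I := by
  -- Conversion factor: the compactness theorem uses Lebesgue measure on the cell, the energy bounds
  -- the normalized one.
  set c : ℝ := (volume.restrict (dualCell b) Set.univ).toReal
  have hc : 0 ≤ c := ENNReal.toReal_nonneg
  have hone : ∀ (p q : Fin m) n, ∫ k, ‖gaugeLift b (U n) k p q‖ ^ 2 ∂(cellMeasure b) ≤ 1 := by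
    intro p q n
    have h1 : ∫ _k, (1 : ℝ) ∂(cellMeasure b) = 1 := by simp
    rw [← h1]
    refine integral_mono (integrable_norm_sq_of_memLp ((hU n p q).1.memLp_cellMeasure b))
      (integrable_const _) fun k => ?_
    exact pow_le_one₀ (norm_nonneg _) ((isUnitaryField_gaugeLift (hU n)).norm_le k p q)
  obtain ⟨φ, hφ, u, v, hu, hv, huv, hae, hw⟩ := exists_subseq_periodic (b := b)
    (ι := Fin m × Fin m) (fun i n k => gaugeLift b (U n) k i.1 i.2)
    (fun i j n k => gaugePartial b j (U n) k i.1 i.2) (fun i n => (hU n i.1 i.2).1)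
    (fun i j n => (hU n i.1 i.2).weakPartial j) (fun i j n => (hU n i.1 i.2).hasWeakPartial j)
    (fun i n k l => by rw [gaugeLift_add]) (c * max 1 C)
    (fun i n => by
      rw [setIntegral_dualCell]
      gcongr
      exact (hone i.1 i.2 n).trans (le_max_left _ _))
    (fun i j n => by
      rw [setIntegral_dualCell]
      gcongr
      exact (hC n j i.1 i.2).trans (le_max_right _ _))
  set V := limitGauge fun n => U (φ n)
  have hlim : ∀ᵐ k : Eu d, ∀ p q,
      Tendsto (fun n => gaugeLift b (U (φ n)) k p q) atTop (𝓝 (gaugeLift b V k p q)) := by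
    filter_upwards [hae] with k hk
    exact tendsto_limitGauge (L := fun p q => u (p, q) k) fun p q => hk (p, q)
  -- The compactness limit and the limit gauge agree only a.e., but that is enough to transfer the
  -- weak derivatives to a genuine unitary map on the torus.
  have huV : ∀ p q, u (p, q) =ᵐ[volume] fun k => gaugeLift b V k p q := fun p q => by
    filter_upwards [hae, hlim] with k h1 h2
    exact tendsto_nhds_unique (h1 (p, q)) (h2 p q)
  have hpart : ∀ j p q, HasWeakPartial j (fun k => gaugeLift b V k p q) (v (p, q) j) :=
    fun j p q => (huv (p, q) j).congr_left (huV p q)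
  have hV : V ∈ gaugeSpace b m := fun p q =>
    ⟨(hu (p, q)).congr (huV p q), fun j => ⟨_, hv (p, q) j, hpart j p q⟩⟩
  refine ⟨V, hV, ?_⟩
  choose B hB hBlim using fun j => exists_tendsto_le_gaugeEnergy (μ := cellMeasure b)
    (A := berry b χ j) (U := fun n => gaugeLift b (U (φ n)))
    (V := fun n => gaugePartial b j (U (φ n))) (u := gaugeLift b V) (v := gaugePartial b j V)
    (matrixMemL2_berry hχ hχW j) (fun n => isUnitaryField_gaugeLift (hU _))
    (fun n => matrixMemL2_gaugePartial (hU _) j) (isUnitaryField_gaugeLift hV)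
    (matrixMemL2_gaugePartial hV j) (C := C) (fun p q n => hC _ j p q)
    (ae_cellMeasure_of_ae b hlim)
    (fun p q => ((hw (p, q) j).cellMeasure b).congr_right
      (ae_cellMeasure_of_ae b (hpart j p q).weakPartial_ae_eq.symm))
  rw [mvFunctional_eq hχ hχW hV]
  refine le_of_tendsto_of_tendsto' ((tendsto_finsetSum Finset.univ fun j _ => hBlim j).add_const _)
    (hI.comp hφ.tendsto_atTop) fun n => ?_
  simp only [Function.comp_apply]
  rw [mvFunctional_eq hχ hχW (hU (φ n))]
  gcongr with j
  exact hB j n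

lemma exists_isMinOn_mvFunctional {P : Eu d → (Hf b →L[ℂ] Hf b)} {χ : Fin m → Eu d → Hf b}
    (hχ : IsBlochFrame b P χ) (hχW : ∀ a, MemWtilde b (χ a)) :
    ∃ U ∈ gaugeSpace b m, IsMinOn (mvFunctional b χ) (gaugeSpace b m) U := by
  obtain ⟨K, hK⟩ := exists_gauge_bounded hχ hχW
  have hbdd : BddBelow (mvFunctional b χ '' gaugeSpace b m) := by
    refine ⟨-K, ?_⟩
    rintro _ ⟨U, hU, rfl⟩
    obtain ⟨V, -, -, h, -⟩ := hK U hU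
    exact h
  obtain ⟨s, -, hs, hsU⟩ := exists_seq_tendsto_sInf
    (Set.Nonempty.image (mvFunctional b χ) ⟨_, one_mem_gaugeSpace (b := b) (m := m)⟩) hbdd
  choose U hU hUs using hsU
  -- Renormalizing each term keeps the functional values, so the sequence remains minimizing while
  -- acquiring a gradient bound from the boundedness of those values.
  choose V hV hVU hlow hVC using fun n => hK (U n) (hU n)
  obtain ⟨M, hM⟩ := hs.bddAbove_range
  obtain ⟨W, hW, hWI⟩ := exists_gauge_le_of_tendsto hχ hχW (U := V) hV (C := 2 * (M + K))
    (fun n j p q => (hVC n j p q).trans (by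
      have := hM ⟨n, rfl⟩
      rw [hUs n]
      linarith))
    (hs.congr fun n => by rw [hVU, hUs])
  exact ⟨W, hW, fun U hU => hWI.trans (csInf_le hbdd ⟨U, hU, rfl⟩)⟩

end Minimization

end BlochMV

end

theorem mainTheorem3 {d m : ℕ} (b : Module.Basis (Fin d) ℝ (BlochMV.Eu d))
    (P : BlochMV.Eu d → (BlochMV.Hf b →L[ℂ] BlochMV.Hf b))
    (hP : BlochMV.IsProjectorFamily b m P)
    (hP1 : BlochMV.HasAnalyticExtension b P)
    (hP2 : BlochMV.IsTauCovariant b P)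
    (χ : Fin m → BlochMV.Eu d → BlochMV.Hf b)
    (hχ : BlochMV.IsBlochFrame b P χ)
    (hχW : ∀ a, BlochMV.MemWtilde b (χ a)) :
    ∃ U ∈ BlochMV.gaugeSpace b m,
      IsMinOn (BlochMV.mvFunctional b χ) (BlochMV.gaugeSpace b m) U :=
  BlochMV.exists_isMinOn_mvFunctional hχ hχW
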